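/- Let $N$ be a simply connected 2-step nilpotent Lie group with Lie algebra $\mathfrak n$ (bracket of left-invariant vector fields), let $\langle\,,\rangle$ be a nondegenerate symmetric bilinear form on $\mathfrak n$ of arbitrary signature, and endow $N$ with the induced left-invariant pseudoriemannian metric. Assume that the center $\mathfrak z$ of $\mathfrak n$ is nondegenerate and $\dim\mathfrak z=1$, and put $\mathfrak v=\mathfrak z^\perp$, so $\mathfrak n=\mathfrak z\oplus\mathfrak v$. For $z\in\mathfrak z$ let $J_z:\mathfrak v\to\mathfrak v$ be given by $\langle J_zx,y\rangle=\langle z,[x,y]\rangle$. Let $\gamma:\mathbb R\to N$ be a geodesic with $\gamma(0)=1$ and $\dot\gamma(0)=z_0+x_0$, $z_0\in\mathfrak z$, $x_0\in\mathfrak v$, and let $J=J_{z_0}$. The point $\gamma(t)$, $t\neq0$, is conjugate to $\gamma(0)$ along $\gamma$ if some nontrivial Jacobi field along $\gamma$ vanishes at $0$ and at $t$; $\mathrm{mult}_{cp}(t)$ denotes the dimension of the space of Jacobi fields along $\gamma$ vanishing at $0$ and $t$. Let $-\lambda_1^2,\dots,-\lambda_q^2$ ($\lambda_k>0$) be the distinct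 negative eigenvalues of $J^2$, let $\mathrm{mult}_{ev}(-\lambda_h^2)=\dim\ker(J^2+\lambda_h^2I)$, write $\mathbb Z^*=\mathbb Z\setminus\{0\}$, and for real $a,b$ let $a\mid b$ mean $b\in a\mathbb Z^*$. For $n\in\mathbb Z^*$ put $$S(k,n)=\sum_{h:\ \lambda_k/n\,\mid\,\lambda_h}\mathrm{mult}_{ev}(-\lambda_h^2).$$ 1. If $z_0\ne0$ and $x_0=0$, then $\gamma(t)$ is conjugate to $\gamma(0)$ along $\gamma$ if and only if $t\in\bigcup_{k=1}^q\frac{2\pi}{\lambda_k}\mathbb Z^*$, and $\mathrm{mult}_{cp}(2\pi n/\lambda_k)=S(k,n)\le\dim\mathfrak v$. 2. If $z_0=0$ and $x_0\neq0$, then $\gamma(t)$, $t\ne0$, is conjugate to $\gamma(0)$ along $\gamma$ if and only if $-\frac{12}{t^2}=\varepsilon\langle J_zx_0,J_zx_0\rangle$, where $z\in\mathfrak z$ is any unit vector, $\varepsilon=\langle z,z\rangle=\pm1$; and then $\mathrm{mult}_{cp}(t)=1$. 3. If $z_0\neq0$ and $x_0\ne0$, then $\gamma(t)$ is conjugate to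 $\gamma(0)$ along $\gamma$ if and only if either $t\in\bigcup_{k=1}^q\frac{2\pi}{\lambda_k}\mathbb Z^*$, or $e^{-tJ}-I$ is invertible and $$t\,\langle Jx_0,(e^{-tJ}-I)^{-1}x_0\rangle=\langle\dot\gamma,\dot\gamma\rangle ,$$ in which latter case $\mathrm{mult}_{cp}(t)=1$. For $t=2\pi n/\lambda_k$ with $n\in\mathbb Z^*$: if $x_0\notin\mathrm{im}(e^{-tJ}-I)$, then $\mathrm{mult}_{cp}(t)=S(k,n)-1$; if $x_0\in\mathrm{im}(e^{-tJ}-I)$, then for any $v\in\mathfrak v$ with $(e^{-tJ}-I)v=tx_0$, $$\mathrm{mult}_{cp}(t)=\begin{cases}S(k,n)+1&\text{if }\langle Jx_0,v\rangle=\langle\dot\gamma,\dot\gamma\rangle,\\ S(k,n)&\text{if }\langle Jx_0,v\rangle\neq\langle\dot\gamma,\dot\gamma\rangle.\end{cases}$$ -/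

import Mathlib

open scoped Manifold ContDiff

noncomputable section

namespace TwoStep

/-! ### Scalar products and the algebra of a left-invariant metric -/

/-- An inner product on a real vector space: a nondegenerate symmetric bilinear form, of
arbitrary signature. -/
structure ScalarProduct (V : Type*) [AddCommGroup V] [Module ℝ V] where
  /-- the underlying bilinear form -/
  form : LinearMap.BilinForm ℝ V
  symm : form.IsSymm
  nondeg : form.Nondegenerate

/-- A Lie algebra is 2-step nilpotent if it is not abelian and all brackets are central. -/
def IsTwoStepNilpotent (𝔫 : Type*) [LieRing 𝔫] [LieAlgebra ℝ 𝔫] : Prop :=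
  ¬ IsLieAbelian 𝔫 ∧ ∀ x y : 𝔫, ⁅x, y⁆ ∈ LieAlgebra.center ℝ 𝔫

/-- The center `𝔷` of a Lie algebra, as a linear subspace. -/
def centerSpace (𝔫 : Type*) [LieRing 𝔫] [LieAlgebra ℝ 𝔫] : Submodule ℝ 𝔫 :=
  (LieAlgebra.center ℝ 𝔫).toSubmodule

section Algebra

variable {𝔫 : Type*} [LieRing 𝔫] [LieAlgebra ℝ 𝔫]

namespace ScalarProduct

variable (g : ScalarProduct 𝔫)

lemma ext_form {a b : 𝔫} (h : ∀ y, g.form a y = g.form b y) : a = b := by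
  have := g.nondeg.1 (a - b) (fun y => by simp [h y])
  exact sub_eq_zero.mp this

/-- The orthogonal complement `𝔳 = 𝔷^⊥` of the center. -/
def vSpace : Submodule ℝ 𝔫 := g.form.orthogonal (centerSpace 𝔫)

/-- The center is nondegenerate: the scalar product restricts to a nondegenerate form on it. -/
def CenterNondegenerate : Prop := (g.form.restrict (centerSpace 𝔫)).Nondegenerate

variable [FiniteDimensional ℝ 𝔫]

/-- The adjoint `ad†_x` of `ad_x` with respect to the scalar product. -/
def adDagger (x : 𝔫) : 𝔫 →ₗ[ℝ] 𝔫 :=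
  g.form.leftAdjointOfNondegenerate g.nondeg (LieAlgebra.ad ℝ 𝔫 x)

lemma form_adDagger (x w y : 𝔫) : g.form (g.adDagger x w) y = g.form w ⁅x, y⁆ :=
  LinearMap.BilinForm.isAdjointPairLeftAdjointOfNondegenerate g.form g.nondeg
    (LieAlgebra.ad ℝ 𝔫 x) w y

lemma adDagger_center_mem (x : 𝔫) (z : centerSpace 𝔫) : g.adDagger x z ∈ g.vSpace := by
  intro c hc
  have hc' : ⁅x, c⁆ = 0 := (LieModule.mem_maxTrivSubmodule ℝ 𝔫 𝔫 c).1 hc x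
  show g.form c (g.adDagger x z) = 0
  rw [g.symm.eq, form_adDagger, hc', map_zero]

/-- The operator `J_z = ad†_• z` on `𝔳`, for `z ∈ 𝔷`; thus `⟨J_z x, y⟩ = ⟨z, [x, y]⟩`. -/
def J (z : centerSpace 𝔫) : Module.End ℝ g.vSpace where
  toFun x := ⟨g.adDagger x z, g.adDagger_center_mem x z⟩
  map_add' x y := by
    apply Subtype.ext
    apply g.ext_form
    intro w
    simp [form_adDagger]
  map_smul' c x := by
    apply Subtype.ext
    apply g.ext_form
    intro w
    simp [form_adDagger]

/-- The Levi-Civita connection of the left-invariant metric, evaluated on left-invariant vector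
fields: `∇_x y = ½ ([x, y] - ad†_x y - ad†_y x)`. -/
def nabla (x y : 𝔫) : 𝔫 := (1 / 2 : ℝ) • (⁅x, y⁆ - g.adDagger x y - g.adDagger y x)

lemma nabla_torsion_free (x y : 𝔫) : g.nabla x y - g.nabla y x = ⁅x, y⁆ := by
  rw [nabla, nabla, ← lie_skew x y]
  module

lemma nabla_metric (x y w : 𝔫) : g.form (g.nabla x y) w + g.form y (g.nabla x w) = 0 := by
  rw [g.symm.eq y]
  simp only [nabla, map_smul, map_sub, LinearMap.smul_apply, LinearMap.sub_apply, form_adDagger]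
  rw [g.symm.eq ⁅x, y⁆, g.symm.eq ⁅x, w⁆, ← lie_skew w y, map_neg]
  simp only [smul_eq_mul]
  ring

/-- The two properties above characterize `nabla`. -/
lemma eq_nabla_of_torsion_free_of_metric (D : 𝔫 → 𝔫 → 𝔫)
    (ht : ∀ x y, D x y - D y x = ⁅x, y⁆)
    (hm : ∀ x y w, g.form (D x y) w + g.form y (D x w) = 0) (x y : 𝔫) :
    D x y = g.nabla x y := by
  apply g.ext_form
  intro w
  simp only [nabla, map_smul, map_sub, LinearMap.smul_apply, LinearMap.sub_apply, form_adDagger,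
    smul_eq_mul, ← ht]
  have h1 := hm x y w
  have h2 := hm y w x
  have h3 := hm w x y
  have s1 := g.symm.eq (D x w) y
  have s2 := g.symm.eq (D y x) w
  have s3 := g.symm.eq (D w y) x
  have s4 := g.symm.eq (D y w) x
  have s5 := g.symm.eq (D w x) y
  linarith

/-- The curvature `R(x, y)w = ∇_x ∇_y w - ∇_y ∇_x w - ∇_[x, y] w`, evaluated on left-invariant
vector fields. -/
def curv (x y w : 𝔫) : 𝔫 :=
  g.nabla x (g.nabla y w) - g.nabla y (g.nabla x w) - g.nabla ⁅x, y⁆ w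

end ScalarProduct

end Algebra

/-! ### Linear algebra -/

section Linear

variable {V : Type*} [AddCommGroup V] [Module ℝ V] [FiniteDimensional ℝ V]

/-- The exponential `e^A` of an endomorphism of a finite-dimensional real vector space, through
the matrix exponential in a basis. -/
def expEnd (A : Module.End ℝ V) : Module.End ℝ V :=
  Matrix.toLin (Module.finBasis ℝ V) (Module.finBasis ℝ V)
    (NormedSpace.exp (LinearMap.toMatrix (Module.finBasis ℝ V) (Module.finBasis ℝ V) A))

/-- The operator `e^{-tJ} - I`. -/
def expSub (J : Module.End ℝ V) (t : ℝ) : Module.End ℝ V := expEnd ((-t) • J) - 1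

lemma finite_freq (J : Module.End ℝ V) :
    {l : ℝ | 0 < l ∧ (J ^ 2).HasEigenvalue (-l ^ 2)}.Finite := by
  apply Set.Finite.of_finite_image (f := fun l : ℝ => -l ^ 2)
  · refine (Module.End.finite_hasEigenvalue (J ^ 2)).subset ?_
    rintro _ ⟨l, hl, rfl⟩
    exact hl.2
  · intro a ha b hb hab
    have h : a ^ 2 = b ^ 2 := neg_injective hab
    exact (pow_left_inj₀ ha.1.le hb.1.le two_ne_zero).1 h

/-- The finite set of those `λ > 0` for which `-λ²` is an eigenvalue of `J²`. -/
def freq (J : Module.End ℝ V) : Finset ℝ := (finite_freq J).toFinset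

/-- The multiplicity of an eigenvalue: the dimension of its eigenspace. -/
def multEv (A : Module.End ℝ V) (μ : ℝ) : ℕ := Module.finrank ℝ (A.eigenspace μ)

/-- `a | b` for real numbers: `b` is a nonzero integral multiple of `a`. -/
def RealDvd (a b : ℝ) : Prop := ∃ m : ℤ, m ≠ 0 ∧ b = m * a

open Classical in
/-- The sum of the multiplicities of the eigenvalues `-λ_h²` of `J²` over all `λ_h` with
`λ / n | λ_h`. -/
def multSum (J : Module.End ℝ V) (l : ℝ) (n : ℤ) : ℕ :=
  ∑ h ∈ (freq J).filter (fun h => RealDvd (l / n) h), multEv (J ^ 2) (-h ^ 2)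

/-- The set `⋃ₖ (2π / λₖ) ℤ*`, where `-λₖ²` runs over the negative eigenvalues of `J²`. -/
def resonantTimes (J : Module.End ℝ V) : Set ℝ :=
  {t | ∃ l ∈ freq J, ∃ n : ℤ, n ≠ 0 ∧ t = 2 * Real.pi / l * n}

end Linear

/-! ### Left-invariant metrics on a Lie group -/

section Geometry

variable {E : Type*} [NormedAddCommGroup E] [NormedSpace ℝ E]
  {N : Type*} [TopologicalSpace N] [ChartedSpace E N] [Group N]

instance instLieGroupMinSmoothness [LieGroup 𝓘(ℝ, E) ∞ N] :
    LieGroup 𝓘(ℝ, E) (minSmoothness ℝ 3) N :=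
  LieGroup.of_le (n := ∞) (by
    rw [minSmoothness_of_isRCLikeNormedField]
    exact ENat.LEInfty.out)

instance instFiniteDimensionalTangentSpace [FiniteDimensional ℝ E] (p : N) :
    FiniteDimensional ℝ (TangentSpace 𝓘(ℝ, E) p) :=
  inferInstanceAs (FiniteDimensional ℝ E)

/-- The differential `T_p N → T_1 N` of left translation by `p⁻¹`. -/
def leftTriv (p : N) (u : TangentSpace 𝓘(ℝ, E) p) : GroupLieAlgebra 𝓘(ℝ, E) N :=
  mfderiv 𝓘(ℝ, E) 𝓘(ℝ, E) (fun q : N => p⁻¹ * q) p u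

/-- The velocity of a curve. -/
def velocity (γ : ℝ → N) (t : ℝ) : TangentSpace 𝓘(ℝ, E) (γ t) :=
  mfderiv 𝓘(ℝ, ℝ) 𝓘(ℝ, E) γ t (1 : ℝ)

/-- A vector field along a curve is smooth if its components in a frame of left-invariant vector
fields are smooth. -/
def SmoothAlong (γ : ℝ → N) (Y : ∀ t, TangentSpace 𝓘(ℝ, E) (γ t)) : Prop :=
  ContDiff ℝ ∞ (F := E) (fun t => leftTriv (γ t) (Y t))

variable [LieGroup 𝓘(ℝ, E) ∞ N]

lemma leftTriv_mulInvariantVectorField (p : N) (x : GroupLieAlgebra 𝓘(ℝ, E) N) :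
    leftTriv p (mulInvariantVectorField x p) = x := by
  have M : (∞ : WithTop ℕ∞) ≠ 0 := by simp
  have A : mfderiv 𝓘(ℝ, E) 𝓘(ℝ, E) ((fun q : N => p⁻¹ * q) ∘ (fun q : N => p * q)) 1 =
      ContinuousLinearMap.id _ _ := by
    have : (fun q : N => p⁻¹ * q) ∘ (fun q => p * q) = id := by ext q; simp
    rw [this, id_eq, mfderiv_id]
  rw [mfderiv_comp (I' := 𝓘(ℝ, E)) _ (contMDiff_mul_left.contMDiffAt.mdifferentiableAt M)
    (contMDiff_mul_left.contMDiffAt.mdifferentiableAt M)] at A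
  have h : (mfderiv 𝓘(ℝ, E) 𝓘(ℝ, E) (fun q : N => p⁻¹ * q) (p * 1) : E →L[ℝ] E) =
      (mfderiv 𝓘(ℝ, E) 𝓘(ℝ, E) (fun q : N => p⁻¹ * q) p : E →L[ℝ] E) := by
    rw [mul_one]
  have := congrArg (fun L : E →L[ℝ] E => L x) A
  change (mfderiv 𝓘(ℝ, E) 𝓘(ℝ, E) (fun q : N => p⁻¹ * q) p : E →L[ℝ] E)
    (mfderiv 𝓘(ℝ, E) 𝓘(ℝ, E) (fun q : N => p * q) 1 x) = x
  rw [← h]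
  exact this

lemma mulInvariantVectorField_leftTriv (p : N) (u : TangentSpace 𝓘(ℝ, E) p) :
    mulInvariantVectorField (leftTriv p u) p = u := by
  have M : (∞ : WithTop ℕ∞) ≠ 0 := by simp
  have A : mfderiv 𝓘(ℝ, E) 𝓘(ℝ, E) ((fun q : N => p * q) ∘ (fun q : N => p⁻¹ * q)) p =
      ContinuousLinearMap.id _ _ := by
    have : (fun q : N => p * q) ∘ (fun q => p⁻¹ * q) = id := by ext q; simp
    rw [this, id_eq, mfderiv_id]
  rw [mfderiv_comp (I' := 𝓘(ℝ, E)) _ (contMDiff_mul_left.contMDiffAt.mdifferentiableAt M)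
    (contMDiff_mul_left.contMDiffAt.mdifferentiableAt M)] at A
  have h : (mfderiv 𝓘(ℝ, E) 𝓘(ℝ, E) (fun q : N => p * q) (p⁻¹ * p) : E →L[ℝ] E) =
      (mfderiv 𝓘(ℝ, E) 𝓘(ℝ, E) (fun q : N => p * q) 1 : E →L[ℝ] E) := by
    rw [inv_mul_cancel]
  have := congrArg (fun L : E →L[ℝ] E => L u) A
  change (mfderiv 𝓘(ℝ, E) 𝓘(ℝ, E) (fun q : N => p * q) 1 : E →L[ℝ] E)
    (mfderiv 𝓘(ℝ, E) 𝓘(ℝ, E) (fun q : N => p⁻¹ * q) p u) = u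
  rw [← h]
  exact this

variable [FiniteDimensional ℝ E]
  (g : ScalarProduct (GroupLieAlgebra 𝓘(ℝ, E) N))

/-- The left-invariant pseudoriemannian metric tensor on `N` induced by `g`. -/
def metric (p : N) (u w : TangentSpace 𝓘(ℝ, E) p) : ℝ :=
  g.form (leftTriv p u) (leftTriv p w)

/-- A torsion-free covariant derivative on the tangent bundle that is compatible with the
left-invariant metric is given by `nabla` on left-invariant vector fields. -/
theorem leviCivita_mulInvariantVectorField
    (cov : CovariantDerivative 𝓘(ℝ, E) E (TangentSpace 𝓘(ℝ, E) : N → Type _))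
    (ht : ∀ (X Y : Π p : N, TangentSpace 𝓘(ℝ, E) p) (p : N),
      MDiffAt (T% X) p → MDiffAt (T% Y) p →
        cov Y p (X p) - cov X p (Y p) = VectorField.mlieBracket 𝓘(ℝ, E) X Y p)
    (hm : ∀ (X Y W : Π p : N, TangentSpace 𝓘(ℝ, E) p) (p : N),
      MDiffAt (T% X) p → MDiffAt (T% Y) p → MDiffAt (T% W) p →
        mvfderiv 𝓘(ℝ, E) (fun q => metric g q (Y q) (W q)) p (X p)
          = metric g p (cov Y p (X p)) (W p) + metric g p (Y p) (cov W p (X p)))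
    (x y : GroupLieAlgebra 𝓘(ℝ, E) N) (p : N) :
    cov (mulInvariantVectorField y) p (mulInvariantVectorField x p)
      = mulInvariantVectorField (g.nabla x y) p := by
  have d (v : GroupLieAlgebra 𝓘(ℝ, E) N) := mdifferentiableAt_mulInvariantVectorField v (g := p)
  have hsub (u w : TangentSpace 𝓘(ℝ, E) p) : leftTriv p (u - w) = leftTriv p u - leftTriv p w :=
    map_sub (mfderiv 𝓘(ℝ, E) 𝓘(ℝ, E) (fun q : N => p⁻¹ * q) p) u w
  rw [← g.eq_nabla_of_torsion_free_of_metric (fun x y =>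
    leftTriv p (cov (mulInvariantVectorField y) p (mulInvariantVectorField x p))),
    mulInvariantVectorField_leftTriv]
  · intro x y
    rw [← hsub, ht _ _ p (d x) (d y), ← mulInvariantVector_mlieBracket,
      leftTriv_mulInvariantVectorField]
    rfl
  · intro x y w
    have := hm _ _ _ p (d x) (d y) (d w)
    simp only [metric, leftTriv_mulInvariantVectorField] at this
    rw [← this]
    simp [mvfderiv]

/-- The covariant derivative along `γ` of a vector field `Y` along `γ`. If
`Y = ∑ᵢ yᵢ Eᵢ` in a frame of left-invariant vector fields, this is
`∑ᵢ yᵢ' Eᵢ + ∑ᵢ yᵢ ∇_γ' Eᵢ`. -/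
def covDeriv (γ : ℝ → N) (Y : ∀ t, TangentSpace 𝓘(ℝ, E) (γ t)) (t : ℝ) :
    TangentSpace 𝓘(ℝ, E) (γ t) :=
  mulInvariantVectorField
    (deriv (fun s => (leftTriv (γ s) (Y s) : GroupLieAlgebra 𝓘(ℝ, E) N)) t
      + g.nabla (leftTriv (γ t) (velocity γ t)) (leftTriv (γ t) (Y t))) (γ t)

/-- The curvature tensor of the metric. -/
def curvature (p : N) (u v w : TangentSpace 𝓘(ℝ, E) p) : TangentSpace 𝓘(ℝ, E) p :=
  mulInvariantVectorField (g.curv (leftTriv p u) (leftTriv p v) (leftTriv p w)) p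

/-- A geodesic: a smooth curve `γ : ℝ → N` with `∇_γ' γ' = 0`. -/
def IsGeodesic (γ : ℝ → N) : Prop :=
  ContMDiff 𝓘(ℝ, ℝ) 𝓘(ℝ, E) ∞ γ ∧ ∀ t, covDeriv g γ (velocity γ) t = 0

/-- A Jacobi field along `γ`: a smooth solution of `∇_γ'² Y + R(Y, γ')γ' = 0`. -/
def IsJacobiField (γ : ℝ → N) (Y : ∀ t, TangentSpace 𝓘(ℝ, E) (γ t)) : Prop :=
  SmoothAlong γ Y ∧
    ∀ t, covDeriv g γ (covDeriv g γ Y) t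
      + curvature g (γ t) (Y t) (velocity γ t) (velocity γ t) = 0

/-- `γ(t₀)` is conjugate to `γ(0)` along `γ`: some nontrivial Jacobi field vanishes at `0` and at
`t₀ ≠ 0`. -/
def IsConjugate (γ : ℝ → N) (t₀ : ℝ) : Prop :=
  t₀ ≠ 0 ∧ ∃ Y : ∀ t, TangentSpace 𝓘(ℝ, E) (γ t),
    IsJacobiField g γ Y ∧ Y ≠ 0 ∧ Y 0 = 0 ∧ Y t₀ = 0

/-- The multiplicity of `γ(t₀)`: the dimension of the space of Jacobi fields along `γ` that
vanish at `0` and at `t₀` (the equation is linear, so that these form a linear subspace). -/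
def multCp (γ : ℝ → N) (t₀ : ℝ) : ℕ :=
  Module.finrank ℝ (Submodule.span ℝ
    {Y : ∀ t, TangentSpace 𝓘(ℝ, E) (γ t) | IsJacobiField g γ Y ∧ Y 0 = 0 ∧ Y t₀ = 0})

end Geometry

end TwoStep

end

/-! In a left-invariant frame a geodesic has body velocity `u` with `u' = ad†_u u`, and a field `y`
along it is Jacobi exactly when `w = y' + [u, y]` satisfies the linearized equation `w' = ad†_w u +
ad†_u w`. Let `e` generate the center, put `ε = ⟨e, e⟩` and `j = J_e`, and split `y = a e + b`, `u =
k e + x` along center and complement. Since `ad†_y w` is the central coordinate of `w` times `j` of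
the orthogonal part of `y`, the number `k` is constant, `x' = k j x`, and the central coordinate `c
= a' + ⟨j x, b⟩ / ε` of `w` is a first integral; what remains is `b'' = k j b' + c j x`
(`IsGenerator.isAlgebraicJacobi_iff`).

If `z₀ ≠ 0`, take `e = z₀`, so that `k = 1` and `x = e^{tj} x₀`. As `j` is injective, the solutions
vanishing at `0` are parametrized by pairs `(c, q)`, with `b = e^{tj} q - q + c t e^{tj} x₀` and `a`
found by one integration. Vanishing at `t` becomes `(e^{-tj} - 1) q = c t x₀` and `c ⟨γ', γ'⟩ = ⟨j
x₀, q⟩` (`components_eq_zero_iff`). If `z₀ = 0` the solutions are polynomials in `t`, and the same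
computation gives the condition with the constant `12` (`horizontal_eq_zero_iff`).

The dimension of the space `solSpace` of such pairs depends on whether `x₀` lies in the range of
`e^{-tj} - 1`. If it does not, then `c = 0` and the second condition cuts the kernel by one
dimension; if `(e^{-tj} - 1) v = t x₀`, that condition is trivial on the kernel, and `c` is free or
zero according as `⟨j x₀, v⟩ = ⟨γ', γ'⟩` or not. Both facts rest on the range being orthogonal to
the kernel and exhausting its orthogonal complement.

Finally `ker (e^{-tj} - 1)` is the direct sum of the eigenspaces of `j²` for `-h²` with `h t ∈ 2πℤ`
(`ker_expSub_eq_biSup`). The form is indefinite, so semisimplicity is not automatic: on the kernel,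
`-tj` generates a circle action, and averaging a positive definite form over it makes `j` skew for a
definite form. -/

noncomputable section

namespace TwoStep

/-! ### Calculus of curves in real vector spaces without a chosen norm -/

section WeakCalculus

variable {V W U : Type*} [AddCommGroup V] [Module ℝ V] [AddCommGroup W] [Module ℝ W]
  [AddCommGroup U] [Module ℝ U]

/-- The derivative of a curve in a real vector space, tested against linear functionals. -/
def HasWeakDerivAt (f : ℝ → V) (f' : V) (t : ℝ) : Prop :=
  ∀ φ : V →ₗ[ℝ] ℝ, HasDerivAt (fun s => φ (f s)) (φ f') t

/-- Smoothness of a curve in a real vector space, tested against linear functionals. -/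
def WeakSmooth (f : ℝ → V) : Prop := ∀ φ : V →ₗ[ℝ] ℝ, ContDiff ℝ ∞ (fun s => φ (f s))

lemma eq_of_forall_dual {a b : V} (h : ∀ φ : V →ₗ[ℝ] ℝ, φ a = φ b) : a = b := by
  rw [← sub_eq_zero, ← Module.forall_dual_apply_eq_zero_iff ℝ]
  intro φ
  rw [map_sub, h, sub_self]

/-- Reduces the product rule for `B` to sums of scalar functions times linear images of a curve, for
which weak derivatives are immediate. -/
lemma bilin_eq_sum [FiniteDimensional ℝ V] (B : V →ₗ[ℝ] W →ₗ[ℝ] U) (v : V) (w : W) :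
    B v w = ∑ i, (Module.finBasis ℝ V).coord i v • B (Module.finBasis ℝ V i) w :=
  calc B v w = B (∑ i, (Module.finBasis ℝ V).repr v i • Module.finBasis ℝ V i) w := by
        rw [(Module.finBasis ℝ V).sum_repr]
    _ = _ := by
        simp only [map_sum, map_smul, LinearMap.sum_apply, LinearMap.smul_apply,
          Module.Basis.coord_apply]

namespace HasWeakDerivAt

variable {f h : ℝ → V} {f' h' : V} {t : ℝ}

lemma unique (hf : HasWeakDerivAt f f' t) (hf' : HasWeakDerivAt f h' t) : f' = h' :=
  eq_of_forall_dual fun φ => (hf φ).unique (hf' φ)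

lemma congr_deriv (hf : HasWeakDerivAt f f' t) (e : f' = h') : HasWeakDerivAt f h' t := e ▸ hf

lemma add (hf : HasWeakDerivAt f f' t) (hh : HasWeakDerivAt h h' t) :
    HasWeakDerivAt (fun s => f s + h s) (f' + h') t := fun φ => by
  simpa using (hf φ).fun_add (hh φ)

lemma sub (hf : HasWeakDerivAt f f' t) (hh : HasWeakDerivAt h h' t) :
    HasWeakDerivAt (fun s => f s - h s) (f' - h') t := fun φ => by
  simpa using (hf φ).fun_sub (hh φ)

lemma const (a : V) : HasWeakDerivAt (fun _ => a) 0 t := fun φ => by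
  simpa using hasDerivAt_const t (φ a)

lemma smul {c : ℝ → ℝ} {c' : ℝ} (hc : HasDerivAt c c' t) (hf : HasWeakDerivAt f f' t) :
    HasWeakDerivAt (fun s => c s • f s) (c' • f t + c t • f') t := fun φ => by
  simpa using hc.fun_mul (hf φ)

lemma smul_const {c : ℝ → ℝ} {c' : ℝ} (hc : HasDerivAt c c' t) (a : V) :
    HasWeakDerivAt (fun s => c s • a) (c' • a) t := by
  simpa using smul hc (const (t := t) a)

lemma map (L : V →ₗ[ℝ] W) (hf : HasWeakDerivAt f f' t) :
    HasWeakDerivAt (fun s => L (f s)) (L f') t := fun φ => hf (φ ∘ₗ L)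

lemma scomp {c : ℝ → ℝ} {c' : ℝ} (hf : HasWeakDerivAt f f' (c t)) (hc : HasDerivAt c c' t) :
    HasWeakDerivAt (fun s => f (c s)) (c' • f') t := fun φ => by
  have := (hf φ).comp t hc
  simpa [Function.comp_def, mul_comm] using this

lemma sum {ι : Type*} (s : Finset ι) {f : ι → ℝ → V} {f' : ι → V}
    (hf : ∀ i ∈ s, HasWeakDerivAt (f i) (f' i) t) :
    HasWeakDerivAt (fun r => ∑ i ∈ s, f i r) (∑ i ∈ s, f' i) t := fun φ => by
  simp only [map_sum]
  exact HasDerivAt.fun_sum fun i hi => hf i hi φ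

lemma bilin [FiniteDimensional ℝ V] (B : V →ₗ[ℝ] W →ₗ[ℝ] U) {k : ℝ → W} {k' : W}
    (hf : HasWeakDerivAt f f' t) (hk : HasWeakDerivAt k k' t) :
    HasWeakDerivAt (fun s => B (f s) (k s)) (B f' (k t) + B (f t) k') t := by
  have := sum Finset.univ fun i _ =>
    smul (hf ((Module.finBasis ℝ V).coord i)) (hk.map (B (Module.finBasis ℝ V i)))
  simp only [← bilin_eq_sum] at this
  rwa [Finset.sum_add_distrib, ← bilin_eq_sum, ← bilin_eq_sum] at this

lemma eq_const (hf : ∀ t, HasWeakDerivAt f 0 t) (s : ℝ) : f s = f 0 :=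
  eq_of_forall_dual fun φ => is_const_of_deriv_eq_zero
    (fun t => (hf t φ).differentiableAt) (fun t => by simpa using (hf t φ).deriv) s 0

end HasWeakDerivAt

namespace WeakSmooth

variable {f h : ℝ → V}

lemma add (hf : WeakSmooth f) (hh : WeakSmooth h) : WeakSmooth (fun s => f s + h s) := fun φ => by
  simpa using (hf φ).add (hh φ)

lemma sub (hf : WeakSmooth f) (hh : WeakSmooth h) : WeakSmooth (fun s => f s - h s) := fun φ => by
  simpa using (hf φ).sub (hh φ)

lemma const (a : V) : WeakSmooth (fun _ : ℝ => a) := fun _ => contDiff_const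

lemma smul {c : ℝ → ℝ} (hc : ContDiff ℝ ∞ c) (hf : WeakSmooth f) :
    WeakSmooth (fun s => c s • f s) := fun φ => by
  simpa using hc.mul (hf φ)

lemma map (L : V →ₗ[ℝ] W) (hf : WeakSmooth f) : WeakSmooth (fun s => L (f s)) :=
  fun φ => hf (φ ∘ₗ L)

lemma sum {ι : Type*} (s : Finset ι) {f : ι → ℝ → V} (hf : ∀ i ∈ s, WeakSmooth (f i)) :
    WeakSmooth (fun r => ∑ i ∈ s, f i r) := fun φ => by
  simp only [map_sum]
  exact ContDiff.sum fun i hi => hf i hi φ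

lemma scomp {c : ℝ → ℝ} (hf : WeakSmooth f) (hc : ContDiff ℝ ∞ c) :
    WeakSmooth (fun s => f (c s)) := fun φ => (hf φ).comp hc

lemma exists_deriv [FiniteDimensional ℝ V] (hf : WeakSmooth f) :
    ∃ f' : ℝ → V, WeakSmooth f' ∧ ∀ t, HasWeakDerivAt f (f' t) t := by
  set b := Module.finBasis ℝ V
  refine ⟨fun t => ∑ i, deriv (fun s => b.coord i (f s)) t • b i, ?_, fun t => ?_⟩
  · exact sum _ fun i _ => smul ((contDiff_infty_iff_deriv.1 (hf (b.coord i))).2) (const _)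
  · have := HasWeakDerivAt.sum (t := t) Finset.univ fun i _ => HasWeakDerivAt.smul_const
      ((contDiff_infty_iff_deriv.1 (hf (b.coord i))).1 t).hasDerivAt (b i)
    simpa [b.sum_repr] using this

end WeakSmooth

end WeakCalculus

/-! ### The exponential as a one-parameter group and as the flow of `y' = J y` -/

section Exponential

variable {V : Type*} [AddCommGroup V] [Module ℝ V] [FiniteDimensional ℝ V]

open scoped Matrix.Norms.Operator in
lemma expEnd_hasWeakDerivAt (J : Module.End ℝ V) (t : ℝ) :
    HasWeakDerivAt (fun s : ℝ => expEnd (s • J)) (J * expEnd (t • J)) t := by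
  intro φ
  set b := Module.finBasis ℝ V
  have h := hasDerivAt_exp_smul_const' (𝕂 := ℝ) (LinearMap.toMatrix b b J) t
  have h' := (LinearMap.toContinuousLinearMap
    (φ ∘ₗ (Matrix.toLin b b).toLinearMap)).hasFDerivAt.comp_hasDerivAt t h
  have e (s : ℝ) : expEnd (s • J) =
      Matrix.toLin b b (NormedSpace.exp (s • LinearMap.toMatrix b b J)) := by
    rw [expEnd, map_smul]
  have e' : J * expEnd (t • J) = Matrix.toLin b b
      (LinearMap.toMatrix b b J * NormedSpace.exp (t • LinearMap.toMatrix b b J)) := by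
    rw [Matrix.toLin_mul b b b, Matrix.toLin_toMatrix, e, Module.End.mul_eq_comp]
  simp only [e']
  simp only [e]
  exact h'

lemma commute_expEnd (J : Module.End ℝ V) (t : ℝ) : Commute J (expEnd (t • J)) := by
  set b := Module.finBasis ℝ V
  have h : Commute (LinearMap.toMatrix b b J) (NormedSpace.exp (LinearMap.toMatrix b b (t • J))) := by
    apply Commute.exp_right
    rw [map_smul]
    exact (Commute.refl _).smul_right t
  have := congrArg (Matrix.toLin b b) h.eq
  rw [Matrix.toLin_mul b b b, Matrix.toLin_mul b b b, Matrix.toLin_toMatrix] at this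
  exact this

@[simp] lemma expEnd_zero : expEnd (0 : Module.End ℝ V) = 1 := by
  simp [expEnd, NormedSpace.exp_zero, Module.End.one_eq_id]

lemma expEnd_add_smul (J : Module.End ℝ V) (s t : ℝ) :
    expEnd ((s + t) • J) = expEnd (s • J) * expEnd (t • J) := by
  set b := Module.finBasis ℝ V
  have h := Matrix.exp_add_of_commute (s • LinearMap.toMatrix b b J) (t • LinearMap.toMatrix b b J)
    (((Commute.refl _).smul_right t).smul_left s)
  simp only [expEnd, map_smul]
  rw [add_smul, h, Matrix.toLin_mul b b b, Module.End.mul_eq_comp]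

lemma expEnd_neg_mul (J : Module.End ℝ V) (t : ℝ) : expEnd ((-t) • J) * expEnd (t • J) = 1 := by
  rw [← expEnd_add_smul]; simp

lemma expEnd_mul_neg (J : Module.End ℝ V) (t : ℝ) : expEnd (t • J) * expEnd ((-t) • J) = 1 := by
  rw [← expEnd_add_smul]; simp

lemma expEnd_smul_apply_hasWeakDerivAt (J : Module.End ℝ V) (v : V) (t : ℝ) :
    HasWeakDerivAt (fun s : ℝ => expEnd (s • J) v) (J (expEnd (t • J) v)) t :=
  (expEnd_hasWeakDerivAt J t).map (LinearMap.applyₗ v)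

lemma apply_expEnd (J : Module.End ℝ V) (t : ℝ) (v : V) :
    J (expEnd (t • J) v) = expEnd (t • J) (J v) :=
  congrArg (fun L : Module.End ℝ V => L v) (commute_expEnd J t).eq

@[simp] lemma expEnd_neg_apply_expEnd (J : Module.End ℝ V) (t : ℝ) (v : V) :
    expEnd ((-t) • J) (expEnd (t • J) v) = v :=
  congrArg (fun L : Module.End ℝ V => L v) (expEnd_neg_mul J t)

@[simp] lemma expEnd_apply_expEnd_neg (J : Module.End ℝ V) (t : ℝ) (v : V) :
    expEnd (t • J) (expEnd ((-t) • J) v) = v :=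
  congrArg (fun L : Module.End ℝ V => L v) (expEnd_mul_neg J t)

lemma expEnd_neg_hasWeakDerivAt (J : Module.End ℝ V) (t : ℝ) :
    HasWeakDerivAt (fun s : ℝ => expEnd ((-s) • J)) (-(J * expEnd ((-t) • J))) t := by
  simpa using (expEnd_hasWeakDerivAt J (-t)).scomp (hasDerivAt_neg t)

/-- Solutions of `y' = J y` are given by the exponential. -/
lemma eq_expEnd_of_hasWeakDerivAt (J : Module.End ℝ V) {y : ℝ → V}
    (hy : ∀ t, HasWeakDerivAt y (J (y t)) t) (t : ℝ) : y t = expEnd (t • J) (y 0) := by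
  have h (s : ℝ) : HasWeakDerivAt (fun s => expEnd ((-s) • J) (y s)) 0 s := by
    refine ((expEnd_neg_hasWeakDerivAt J s).bilin LinearMap.id (hy s)).congr_deriv ?_
    have := apply_expEnd J (-s) (y s)
    simp only [LinearMap.id_apply, LinearMap.neg_apply, Module.End.mul_apply, this,
      neg_add_cancel]
  have := HasWeakDerivAt.eq_const h t
  simp only [neg_zero, zero_smul, expEnd_zero, Module.End.one_apply] at this
  rw [← this, expEnd_apply_expEnd_neg]

lemma expEnd_weakSmooth (J : Module.End ℝ V) : WeakSmooth (fun s : ℝ => expEnd (s • J)) := by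
  intro φ
  refine contDiff_infty.2 fun n => ?_
  -- The functional must vary in the induction: differentiating replaces `φ` by its composite with
  -- left multiplication by `J`.
  suffices ∀ φ : Module.End ℝ V →ₗ[ℝ] ℝ, ContDiff ℝ n (fun s : ℝ => φ (expEnd (s • J))) from this φ
  induction n with
  | zero => exact fun φ => contDiff_zero.2 (continuous_iff_continuousAt.2 fun t =>
      (expEnd_hasWeakDerivAt J t φ).continuousAt)
  | succ n ih =>
    intro φ
    rw [show ((n + 1 : ℕ) : WithTop ℕ∞) = (n : WithTop ℕ∞) + 1 by norm_cast,
      contDiff_succ_iff_deriv]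
    refine ⟨fun t => (expEnd_hasWeakDerivAt J t φ).differentiableAt, by simp, ?_⟩
    rw [funext fun t => (expEnd_hasWeakDerivAt J t φ).deriv]
    exact ih (φ ∘ₗ LinearMap.mulLeft ℝ J)

lemma expEnd_apply_weakSmooth (J : Module.End ℝ V) (v : V) :
    WeakSmooth (fun s : ℝ => expEnd (s • J) v) :=
  (expEnd_weakSmooth J).map (LinearMap.applyₗ v)

lemma expEnd_neg_apply_weakSmooth (J : Module.End ℝ V) (v : V) :
    WeakSmooth (fun s : ℝ => expEnd ((-s) • J) v) :=
  (expEnd_apply_weakSmooth J v).scomp contDiff_neg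

end Exponential

/-! ### The kernel of `e^{-tJ} - I` and the eigenspaces of `J²` -/

section KernelOfExpSub

open Module.End

lemma finrank_biSup_of_iSupIndep {ι V : Type*} [AddCommGroup V] [Module ℝ V]
    [FiniteDimensional ℝ V] {E : ι → Submodule ℝ V} (hE : iSupIndep E) (s : Finset ι) :
    Module.finrank ℝ (⨆ i ∈ s, E i : Submodule ℝ V) = ∑ i ∈ s, Module.finrank ℝ (E i) := by
  classical
  induction s using Finset.induction_on with
  | empty => simp
  | insert i s hi ih =>
    have hd : Disjoint (E i) (⨆ j ∈ s, E j) := by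
      simpa using hE.disjoint_biSup (x := i) (y := (s : Set ι)) (by simpa using hi)
    have := Submodule.finrank_sup_add_finrank_inf_eq (E i) (⨆ j ∈ s, E j)
    rw [hd.eq_bot, finrank_bot, add_zero, ih] at this
    rw [Finset.iSup_insert, Finset.sum_insert hi, this]

variable {W : Type*} [AddCommGroup W] [Module ℝ W] [FiniteDimensional ℝ W]

/-- The square of an operator that is skew for a definite form is diagonalizable with nonpositive
eigenvalues. -/
lemma iSup_eigenspace_sq_eq_top_of_skew (A : Module.End ℝ W) (Q : LinearMap.BilinForm ℝ W)
    (hsymm : ∀ x y, Q x y = Q y x) (hpos : ∀ x, x ≠ 0 → 0 < Q x x)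
    (hskew : ∀ x y, Q (A x) y = - Q x (A y)) :
    (⨆ μ, (A ^ 2).eigenspace μ) = ⊤ ∧ ∀ μ, (A ^ 2).HasEigenvalue μ → μ ≤ 0 := by
  constructor
  · let core : InnerProductSpace.Core ℝ W :=
      { inner := fun x y => Q x y
        conj_inner_symm := fun x y => hsymm y x
        re_inner_nonneg := fun x => by
          by_cases hx : x = 0
          · simp [hx]
          · exact (hpos x hx).le
        add_left := fun x y z => by simp
        smul_left := fun x y r => by simp
        definite := fun x hx => by
          by_contra h
          exact (hpos x h).ne' hx }
    let _ : NormedAddCommGroup W := core.toNormedAddCommGroup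
    let _ : InnerProductSpace ℝ W := InnerProductSpace.ofCore core.toCore
    have hs : (A ^ 2).IsSymmetric := fun x y => by
      change Q ((A ^ 2) x) y = Q x ((A ^ 2) y)
      simp [pow_two, hskew]
    have := hs.orthogonalComplement_iSup_eigenspaces_eq_bot
    rwa [Submodule.orthogonal_eq_bot_iff] at this
  · intro μ hμ
    obtain ⟨v, hv, hv0⟩ := hμ.exists_hasEigenvector
    rw [mem_eigenspace_iff, pow_two, Module.End.mul_apply] at hv
    -- Skewness turns this into `-Q (A v) (A v) = μ Q v v`, which forces `μ ≤ 0`.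
    have h1 : Q (A (A v)) v = μ * Q v v := by simp [hv]
    rw [hskew] at h1
    have h2 : 0 ≤ Q (A v) (A v) := by
      by_cases h : A v = 0
      · simp [h]
      · exact (hpos _ h).le
    nlinarith [hpos v hv0]

/-- A one-parameter group of period one preserves a definite form. -/
lemma exists_definite_form_of_expEnd_eq_one (A : Module.End ℝ W) (hA : expEnd A = 1) :
    ∃ Q : LinearMap.BilinForm ℝ W, (∀ x y, Q x y = Q y x) ∧ (∀ x, x ≠ 0 → 0 < Q x x) ∧
      ∀ x y, Q (A x) y = - Q x (A y) := by
  set b := Module.finBasis ℝ W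
  -- The dot product in coordinates; `Q` below is its average over one period of the flow `e^{tA}`.
  let q : LinearMap.BilinForm ℝ W := ∑ i, (b.coord i).smulRight (b.coord i)
  have hq (x y : W) : q x y = ∑ i, b.coord i x * b.coord i y := by simp [q]
  have hqs (x y : W) : q x y = q y x := by simp [hq, mul_comm]
  have hqp (x : W) (hx : x ≠ 0) : 0 < q x x := by
    rw [hq]
    refine (Finset.sum_nonneg fun i _ => mul_self_nonneg _).lt_of_ne' fun h => hx ?_
    rw [Finset.sum_eq_zero_iff_of_nonneg fun i _ => mul_self_nonneg _] at h
    exact b.ext_elem fun i => by simpa using h i (Finset.mem_univ i)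
  have hd (x y : W) (t : ℝ) := (expEnd_smul_apply_hasWeakDerivAt A x t).bilin q
    (expEnd_smul_apply_hasWeakDerivAt A y t) LinearMap.id
  simp only [LinearMap.id_apply] at hd
  have hc (x y : W) : Continuous fun t : ℝ => q (expEnd (t • A) x) (expEnd (t • A) y) :=
    continuous_iff_continuousAt.2 fun t => (hd x y t).continuousAt
  have hi (x y : W) : IntervalIntegrable
      (fun t : ℝ => q (expEnd (t • A) x) (expEnd (t • A) y)) MeasureTheory.volume 0 1 :=
    (hc x y).intervalIntegrable 0 1
  let Q : LinearMap.BilinForm ℝ W := LinearMap.mk₂ ℝ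
    (fun x y => ∫ t in (0 : ℝ)..1, q (expEnd (t • A) x) (expEnd (t • A) y))
    (fun x x' y => by
      rw [← intervalIntegral.integral_add (hi x y) (hi x' y)]; simp)
    (fun c x y => by simp)
    (fun x y y' => by
      rw [← intervalIntegral.integral_add (hi x y) (hi x y')]; simp)
    (fun c x y => by simp)
  have hQ (x y : W) :
    Q x y = ∫ t in (0 : ℝ)..1, q (expEnd (t • A) x) (expEnd (t • A) y) := rfl
  refine ⟨Q, fun x y => ?_, fun x hx => ?_, fun x y => ?_⟩
  · simp only [hQ, hqs (expEnd _ x)]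
  · rw [hQ]
    refine intervalIntegral.intervalIntegral_pos_of_pos (hi x x) (fun t => hqp _ fun h => hx ?_)
      one_pos
    rw [← expEnd_neg_apply_expEnd A t x, h, map_zero]
  -- `Q (A x) y + Q x (A y)` is the integral of `d/dt q (e^{tA} x) (e^{tA} y)` over a full period,
  -- hence zero because `e^A = 1`.
  · rw [eq_neg_iff_add_eq_zero, hQ, hQ, ← intervalIntegral.integral_add (hi _ y) (hi x _)]
    simp only [← apply_expEnd]
    rw [intervalIntegral.integral_eq_sub_of_hasDerivAt (fun t _ => hd x y t)]
    · simp [hA]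
    · simp only [apply_expEnd]
      exact (hi (A x) y).add (hi x (A y))

variable {V : Type*} [AddCommGroup V] [Module ℝ V] [FiniteDimensional ℝ V]

lemma mem_freq {J : Module.End ℝ V} {l : ℝ} :
    l ∈ freq J ↔ 0 < l ∧ (J ^ 2).HasEigenvalue (-l ^ 2) := by
  simp [freq]

lemma expEnd_smul_restrict (J : Module.End ℝ V) (K : Submodule ℝ V) (hK : ∀ v ∈ K, J v ∈ K)
    (t : ℝ) (v : K) : (expEnd (t • J.restrict hK) v : V) = expEnd (t • J) v := by
  have := eq_expEnd_of_hasWeakDerivAt J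
    (fun t => (expEnd_smul_apply_hasWeakDerivAt (J.restrict hK) v t).map K.subtype) t
  simpa using this

/-- On the span of `v` and `J v` the flow is a rotation with frequency `l`: the right side solves
`y' = J y` with initial value `v`. -/
lemma expEnd_apply_of_sq_eq {J : Module.End ℝ V} {l : ℝ} (hl : l ≠ 0) {v : V}
    (hv : J (J v) = (-l ^ 2) • v) (t : ℝ) :
    expEnd (t • J) v = Real.cos (l * t) • v + (Real.sin (l * t) / l) • J v := by
  have hlt (t : ℝ) : HasDerivAt (fun t => l * t) l t := by
    simpa using (hasDerivAt_id t).const_mul l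
  have := eq_expEnd_of_hasWeakDerivAt J
    (y := fun t => Real.cos (l * t) • v + (Real.sin (l * t) / l) • J v) (fun t => by
      refine ((HasWeakDerivAt.smul_const (hlt t).cos v).add
        (HasWeakDerivAt.smul_const ((hlt t).sin.div_const l) (J v))).congr_deriv ?_
      rw [map_add, map_smul, map_smul, hv]
      match_scalars <;> field_simp) t
  simpa using this.symm

-- Multiplying `a + b J` by `a - b J` gives the scalar `a² + b² l²` on `v`, which is zero only if `a
-- = b = 0`. Thus `v` and `J v` are linearly independent.
omit [FiniteDimensional ℝ V] in
lemma eq_zero_of_smul_add_smul_eq_zero {J : Module.End ℝ V} {l : ℝ} (hl : l ≠ 0) {v : V}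
    (hv0 : v ≠ 0) (hv : J (J v) = (-l ^ 2) • v) {a b : ℝ} (h : a • v + b • J v = 0) :
    a = 0 ∧ b = 0 := by
  have h2 : a • J v + b • J (J v) = 0 := by simpa using congrArg J h
  have h3 : (a ^ 2 + b ^ 2 * l ^ 2) • v = 0 := by
    have : a • (a • v + b • J v) - b • (a • J v + b • J (J v)) = 0 := by simp [h, h2]
    rw [hv] at this
    rw [← this]
    module
  have h4 := (smul_eq_zero.1 h3).resolve_right hv0
  have hl2 : 0 < l ^ 2 := by positivity
  have hb : b ^ 2 = 0 := by nlinarith [sq_nonneg a, sq_nonneg b]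
  have ha : a ^ 2 = 0 := by nlinarith [sq_nonneg a, sq_nonneg b]
  exact ⟨by simpa using ha, by simpa using hb⟩

lemma mem_ker_expSub {J : Module.End ℝ V} {t : ℝ} {v : V} :
    v ∈ LinearMap.ker (expSub J t) ↔ expEnd ((-t) • J) v = v := by
  simp [expSub, sub_eq_zero]

lemma apply_expSub (J : Module.End ℝ V) (t : ℝ) (v : V) :
    J (expSub J t v) = expSub J t (J v) := by
  simp only [expSub, LinearMap.sub_apply, map_sub, apply_expEnd, Module.End.one_apply]

lemma apply_mem_ker_expSub {J : Module.End ℝ V} {t : ℝ} {v : V}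
    (hv : v ∈ LinearMap.ker (expSub J t)) : J v ∈ LinearMap.ker (expSub J t) := by
  rw [LinearMap.mem_ker] at *
  rw [← apply_expSub, hv, map_zero]

lemma mem_ker_expSub_iff_of_sq_eq {J : Module.End ℝ V} {l : ℝ} (hl : l ≠ 0) {v : V}
    (hv0 : v ≠ 0) (hv : J (J v) = (-l ^ 2) • v) (t : ℝ) :
    v ∈ LinearMap.ker (expSub J t) ↔ ∃ m : ℤ, l * t = m * (2 * Real.pi) := by
  rw [mem_ker_expSub, expEnd_apply_of_sq_eq hl hv]
  simp only [mul_neg, Real.cos_neg, Real.sin_neg]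
  constructor
  · intro h
    have h2 : (Real.cos (l * t) - 1) • v + (-Real.sin (l * t) / l) • J v = 0 := by
      rw [sub_smul, one_smul, sub_add_eq_add_sub, h, sub_self]
    obtain ⟨m, hm⟩ := (Real.cos_eq_one_iff _).1
      (sub_eq_zero.1 (eq_zero_of_smul_add_smul_eq_zero hl hv0 hv h2).1)
    exact ⟨m, hm.symm⟩
  · rintro ⟨m, hm⟩
    have hs : Real.sin (l * t) = 0 := by
      rw [hm, show (m : ℝ) * (2 * Real.pi) = ((2 * m : ℤ) : ℝ) * Real.pi by push_cast; ring]
      exact Real.sin_int_mul_pi _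
    rw [hs, (Real.cos_eq_one_iff _).2 ⟨m, hm.symm⟩]
    simp

-- For `≤`, restrict `A = -tJ` to the kernel, where `e^A = 1`. The averaged form makes `A` skew for
-- a definite form, so `A²` is diagonalizable there with eigenvalues `≤ 0`, and these translate into
-- eigenvalues `-h²` of `J²`. Injectivity of `J` excludes the eigenvalue `0`, whose eigenvectors
-- would lie in the kernel for every `t`. For `≥`, use the rotation formula on each eigenvector.
open Classical in
lemma ker_expSub_eq_biSup {J : Module.End ℝ V} (hJ : Function.Injective J) {t : ℝ} (ht : t ≠ 0) :
    LinearMap.ker (expSub J t) =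
      ⨆ h ∈ (freq J).filter (fun h => ∃ m : ℤ, h * t = m * (2 * Real.pi)),
        (J ^ 2).eigenspace (-h ^ 2) := by
  apply le_antisymm
  · set K := LinearMap.ker (expSub J t) with hKdef
    have hK : ∀ v ∈ K, ((-t) • J) v ∈ K := fun v hv =>
      K.smul_mem _ (apply_mem_ker_expSub hv)
    set A : Module.End ℝ K := LinearMap.restrict ((-t) • J) hK with hAdef
    have hA : expEnd A = 1 := by
      ext v
      have := expEnd_smul_restrict ((-t) • J) K hK 1 v
      rw [one_smul, one_smul, mem_ker_expSub.1 v.2] at this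
      exact this
    obtain ⟨Q, h1, h2, h3⟩ := exists_definite_form_of_expEnd_eq_one A hA
    obtain ⟨htop, hneg⟩ := iSup_eigenspace_sq_eq_top_of_skew A Q h1 h2 h3
    have hle : (⨆ μ, (A ^ 2).eigenspace μ) ≤ Submodule.comap K.subtype
        (⨆ h ∈ (freq J).filter (fun h => ∃ m : ℤ, h * t = m * (2 * Real.pi)),
        (J ^ 2).eigenspace (-h ^ 2)) := by
      refine iSup_le fun μ v hv => ?_
      rw [Submodule.mem_comap]
      by_cases hv0 : v = 0
      · simp [hv0]
      have hμ : μ ≤ 0 := hneg μ (hasEigenvalue_of_hasEigenvector ⟨hv, hv0⟩)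
      have hv0' : (v : V) ≠ 0 := by simpa using hv0
      have hAv : t ^ 2 • J (J v) = μ • (v : V) := by
        rw [mem_eigenspace_iff, pow_two, Module.End.mul_apply] at hv
        have := congrArg (K.subtype) hv
        simp only [hAdef, Submodule.subtype_apply, LinearMap.coe_restrict_apply,
          LinearMap.smul_apply, map_smul] at this
        rw [← this]
        module
      have hμ0 : μ ≠ 0 := by
        rintro rfl
        rw [zero_smul, smul_eq_zero] at hAv
        have := hAv.resolve_left (by positivity)
        exact hv0' (hJ (hJ (by simpa using this)))
      have hpos : 0 < -μ / t ^ 2 := by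
        have : 0 < -μ := by
          rcases hμ.lt_or_eq with h | h
          · linarith
          · exact absurd h hμ0
        positivity
      -- Since `A² = t² J²` on the kernel, the eigenvalue `μ` of `A²` is the eigenvalue `μ / t² =
      -- -h²` of `J²`.
      set h := Real.sqrt (-μ / t ^ 2) with hh
      have hh0 : 0 < h := Real.sqrt_pos.2 hpos
      have hsq : -h ^ 2 = μ / t ^ 2 := by
        rw [hh, Real.sq_sqrt hpos.le]; ring
      have hJv : J (J v) = (-h ^ 2) • (v : V) := by
        have : J (J v) = (t ^ 2)⁻¹ • (t ^ 2 • J (J v)) := by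
          rw [smul_smul, inv_mul_cancel₀ (by positivity), one_smul]
        rw [this, hAv, hsq, smul_smul]
        congr 1
        ring
      have hmem : (v : V) ∈ (J ^ 2).eigenspace (-h ^ 2) := by
        rw [mem_eigenspace_iff, pow_two, Module.End.mul_apply, hJv]
      refine Submodule.mem_iSup_of_mem h (Submodule.mem_iSup_of_mem ?_ hmem)
      rw [Finset.mem_filter, mem_freq]
      exact ⟨⟨hh0, hasEigenvalue_of_hasEigenvector ⟨hmem, hv0'⟩⟩,
        (mem_ker_expSub_iff_of_sq_eq hh0.ne' hv0' hJv t).1 v.2⟩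
    intro v hv
    rw [htop] at hle
    exact hle (x := ⟨v, hv⟩) Submodule.mem_top
  · refine iSup₂_le fun h hh v hv => ?_
    rw [Finset.mem_filter, mem_freq] at hh
    by_cases hv0 : v = 0
    · simp [hv0]
    rw [mem_eigenspace_iff, pow_two, Module.End.mul_apply] at hv
    exact (mem_ker_expSub_iff_of_sq_eq hh.1.1.ne' hv0 hv t).2 hh.2

lemma finrank_ker_expSub {J : Module.End ℝ V} (hJ : Function.Injective J) {l : ℝ}
    (hl : l ∈ freq J) {n : ℤ} (hn : n ≠ 0) :
    Module.finrank ℝ (LinearMap.ker (expSub J (2 * Real.pi / l * n))) = multSum J l n := by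
  have hl0 : l ≠ 0 := (mem_freq.1 hl).1.ne'
  have hn0 : (n : ℝ) ≠ 0 := by exact_mod_cast hn
  have hpi := Real.pi_ne_zero
  -- Indexing by positive `h` makes `h ↦ -h²` injective, so distinct indices give distinct
  -- eigenvalues and the dimensions add.
  have hind : iSupIndep fun h : {h : ℝ // 0 < h} => (J ^ 2).eigenspace (-(h : ℝ) ^ 2) := by
    refine (eigenspaces_iSupIndep (J ^ 2)).comp (f := fun h : {h : ℝ // 0 < h} => -(h : ℝ) ^ 2) ?_
    intro a b hab
    exact Subtype.ext ((pow_left_inj₀ a.2.le b.2.le two_ne_zero).1 (neg_injective hab))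
  classical
  rw [ker_expSub_eq_biSup hJ (by positivity)]
  set s := (freq J).filter (fun h => ∃ m : ℤ, h * (2 * Real.pi / l * n) = m * (2 * Real.pi))
  have hs : ∀ h ∈ s, 0 < h := fun h hh => (mem_freq.1 (Finset.mem_filter.1 hh).1).1
  have e : (⨆ h ∈ s, (J ^ 2).eigenspace (-h ^ 2)) =
      ⨆ h ∈ s.subtype (fun h => 0 < h), (J ^ 2).eigenspace (-(h : ℝ) ^ 2) := by
    apply le_antisymm
    · exact iSup₂_le fun h hh => le_iSup₂_of_le (⟨h, hs h hh⟩ : {h : ℝ // 0 < h})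
        (by simpa using hh) le_rfl
    · exact iSup₂_le fun h hh => le_iSup₂_of_le (h : ℝ) (by simpa using hh) le_rfl
  rw [e, finrank_biSup_of_iSupIndep hind, Finset.sum_subtype_of_mem
    (fun h : ℝ => Module.finrank ℝ ((J ^ 2).eigenspace (-h ^ 2))) hs]
  refine Finset.sum_congr (Finset.filter_congr fun h hh => ?_) fun h _ => rfl
  have hh0 : 0 < h := (mem_freq.1 hh).1
  constructor
  · rintro ⟨m, hm⟩
    have hm' : h = m * (l / n) := by
      field_simp at hm ⊢
      linarith
    refine ⟨m, ?_, hm'⟩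
    rintro rfl
    simp at hm'
    exact hh0.ne' hm'
  · rintro ⟨m, -, hm⟩
    refine ⟨m, ?_⟩
    rw [hm]
    field_simp

lemma mem_resonantTimes_iff {J : Module.End ℝ V} (hJ : Function.Injective J) {t : ℝ} (ht : t ≠ 0) :
    t ∈ resonantTimes J ↔ LinearMap.ker (expSub J t) ≠ ⊥ := by
  classical
  rw [ker_expSub_eq_biSup hJ ht]
  constructor
  · rintro ⟨l, hl, n, hn, rfl⟩ h
    have hl' := mem_freq.1 hl
    refine hl'.2 (le_bot_iff.1 (h ▸ le_iSup₂_of_le l ?_ le_rfl))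
    rw [Finset.mem_filter]
    refine ⟨hl, n, ?_⟩
    have := hl'.1.ne'
    field_simp
  · intro h
    obtain ⟨l, hl⟩ : ((freq J).filter
        (fun h => ∃ m : ℤ, h * t = m * (2 * Real.pi))).Nonempty := by
      rw [Finset.nonempty_iff_ne_empty]
      intro he
      simp [he] at h
    obtain ⟨hl, m, hm⟩ := Finset.mem_filter.1 hl
    have hl' := (mem_freq.1 hl).1.ne'
    refine ⟨l, hl, m, ?_, ?_⟩
    · rintro rfl
      simp [hl', ht] at hm
    · field_simp
      linarith

lemma ne_zero_of_mem_resonantTimes {J : Module.End ℝ V} {t : ℝ} (ht : t ∈ resonantTimes J) :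
    t ≠ 0 := by
  obtain ⟨l, hl, n, hn, rfl⟩ := ht
  have := (mem_freq.1 hl).1.ne'
  have := Real.pi_ne_zero
  have : (n : ℝ) ≠ 0 := by exact_mod_cast hn
  positivity

/-- At a resonant time, every functional has a nonzero zero in the kernel of `e^{-tJ} - I`. -/
lemma exists_mem_ker_expSub_of_mem_resonantTimes {J : Module.End ℝ V} {t : ℝ}
    (ht : t ∈ resonantTimes J) (f : V →ₗ[ℝ] ℝ) :
    ∃ q ∈ LinearMap.ker (expSub J t), q ≠ 0 ∧ f q = 0 := by
  obtain ⟨l, hl, n, hn, rfl⟩ := ht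
  obtain ⟨hl0, hl'⟩ := mem_freq.1 hl
  obtain ⟨v, hv, hv0⟩ := hl'.exists_hasEigenvector
  rw [mem_eigenspace_iff, pow_two, Module.End.mul_apply] at hv
  have hk : v ∈ LinearMap.ker (expSub J (2 * Real.pi / l * n)) :=
    (mem_ker_expSub_iff_of_sq_eq hl0.ne' hv0 hv _).2 ⟨n, by field_simp⟩
  by_cases h : f v = 0
  · exact ⟨v, hk, hv0, h⟩
  -- The kernel contains the plane spanned by `v` and `J v`, and this combination is the one on
  -- which `f` vanishes.
  · refine ⟨f (J v) • v + (-f v) • J v, Submodule.add_mem _ (Submodule.smul_mem _ _ hk)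
      (Submodule.smul_mem _ _ (apply_mem_ker_expSub hk)), fun h0 => h ?_, ?_⟩
    · simpa using (eq_zero_of_smul_add_smul_eq_zero hl0.ne' hv0 hv h0).2
    · simp only [map_add, map_smul, smul_eq_mul]
      ring

end KernelOfExpSub

/-! ### Dimension of the space of parameters `(c, q)` -/

section Counting

variable {V : Type*} [AddCommGroup V] [Module ℝ V] [FiniteDimensional ℝ V]

lemma form_expEnd_expEnd (B : LinearMap.BilinForm ℝ V) {J : Module.End ℝ V}
    (hskew : ∀ x y, B (J x) y = - B x (J y)) (t : ℝ) (x y : V) :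
    B (expEnd (t • J) x) (expEnd (t • J) y) = B x y := by
  have h (s : ℝ) := (expEnd_smul_apply_hasWeakDerivAt J x s).bilin B
    (expEnd_smul_apply_hasWeakDerivAt J y s)
  simp only [hskew, neg_add_cancel] at h
  simpa using HasWeakDerivAt.eq_const h t

lemma form_expEnd_neg (B : LinearMap.BilinForm ℝ V) {J : Module.End ℝ V}
    (hskew : ∀ x y, B (J x) y = - B x (J y)) (t : ℝ) (x y : V) :
    B x (expEnd ((-t) • J) y) = B (expEnd (t • J) x) y := by
  rw [← form_expEnd_expEnd B hskew t, expEnd_apply_expEnd_neg]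

/-- The flow of a skew operator preserves `B` and fixes `k`, so `B (e^{-tJ} v) k = B (e^{-tJ} v)
(e^{-tJ} k) = B v k`. -/
lemma form_apply_eq_zero_of_mem_range_expSub (B : LinearMap.BilinForm ℝ V) {J : Module.End ℝ V}
    (hskew : ∀ x y, B (J x) y = - B x (J y)) {t : ℝ} {x k : V}
    (hx : x ∈ LinearMap.range (expSub J t)) (hk : k ∈ LinearMap.ker (expSub J t)) :
    B x k = 0 := by
  obtain ⟨v, rfl⟩ := hx
  have := form_expEnd_expEnd B hskew (-t) v k
  rw [mem_ker_expSub.1 hk] at this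
  rw [expSub, LinearMap.sub_apply, map_sub, LinearMap.sub_apply, this, Module.End.one_apply, sub_self]

/-- The range lies in the orthogonal complement of the kernel, and by nondegeneracy and rank-nullity
the two have the same dimension. -/
lemma mem_range_expSub_of_form_eq_zero {B : LinearMap.BilinForm ℝ V} (hB : B.Nondegenerate)
    {J : Module.End ℝ V} (hskew : ∀ x y, B (J x) y = - B x (J y)) (hsymm : B.IsSymm)
    {t : ℝ} {x : V} (h : ∀ k ∈ LinearMap.ker (expSub J t), B x k = 0) :
    x ∈ LinearMap.range (expSub J t) := by
  have hle : LinearMap.range (expSub J t) ≤ B.orthogonal (LinearMap.ker (expSub J t)) :=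
    fun y hy k hk => by
      rw [hsymm.eq]
      exact form_apply_eq_zero_of_mem_range_expSub B hskew hy hk
  have hfr := LinearMap.finrank_range_add_finrank_ker (expSub J t)
  rw [Submodule.eq_of_le_of_finrank_eq hle
    (by rw [LinearMap.BilinForm.finrank_orthogonal hB]; omega)]
  intro k hk
  rw [hsymm.eq]
  exact h k hk

/-- The parameters `(c, q)` of the Jacobi fields that vanish at the times `0` and `t`. -/
def solSpace (B : LinearMap.BilinForm ℝ V) (J : Module.End ℝ V) (x₀ : V) (G t : ℝ) :
    Submodule ℝ (ℝ × V) where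
  carrier := {p | expSub J t p.2 = (p.1 * t) • x₀ ∧ p.1 * G = B (J x₀) p.2}
  zero_mem' := by simp
  add_mem' := by
    rintro ⟨c, q⟩ ⟨c', q'⟩ ⟨h1, h2⟩ ⟨h1', h2'⟩
    constructor
    · simp only [Prod.mk_add_mk, map_add] at *
      rw [h1, h1', ← add_smul, add_mul]
    · simp only [Prod.mk_add_mk, map_add] at *
      rw [← h2, ← h2', add_mul]
  smul_mem' := by
    rintro a ⟨c, q⟩ ⟨h1, h2⟩
    constructor
    · simp only [Prod.smul_mk, map_smul] at *
      rw [h1, smul_smul, smul_eq_mul, mul_assoc]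
    · simp only [Prod.smul_mk, map_smul, smul_eq_mul] at *
      rw [← h2, mul_assoc]

variable {B : LinearMap.BilinForm ℝ V} {J : Module.End ℝ V} {x₀ : V} {G t : ℝ}

lemma mem_solSpace {c : ℝ} {q : V} : (c, q) ∈ solSpace B J x₀ G t ↔
    expSub J t q = (c * t) • x₀ ∧ c * G = B (J x₀) q := Iff.rfl

/-- A solution with `c ≠ 0` would put `x₀` in the range. Hence `c = 0`, and the solutions are the
zeros in the kernel of the functional `B (J x₀)`. -/
lemma finrank_solSpace_of_notMem_range (hB : B.Nondegenerate) (hsymm : B.IsSymm)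
    (hskew : ∀ x y, B (J x) y = - B x (J y)) (hJ : Function.Injective J) (ht : t ≠ 0)
    (hx : x₀ ∉ LinearMap.range (expSub J t)) :
    Module.finrank ℝ (solSpace B J x₀ G t) + 1 =
      Module.finrank ℝ (LinearMap.ker (expSub J t)) := by
  set K := LinearMap.ker (expSub J t) with hK
  let f : Module.Dual ℝ K := B (J x₀) ∘ₗ K.subtype
  -- `J` maps the kernel onto itself, so if `f` vanished, skewness would make `x₀` orthogonal to the
  -- kernel and hence an element of the range.
  have hf : f ≠ 0 := by
    intro h
    refine hx (mem_range_expSub_of_form_eq_zero hB hskew hsymm fun k hk => ?_)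
    obtain ⟨k, rfl⟩ := LinearMap.injective_iff_surjective.1 hJ k
    have hk' : k ∈ K := by
      rw [LinearMap.mem_ker] at hk ⊢
      rw [← apply_expSub] at hk
      exact hJ (by simpa using hk)
    have := LinearMap.congr_fun h ⟨k, hk'⟩
    simp only [f, LinearMap.comp_apply, Submodule.subtype_apply, LinearMap.zero_apply, hskew] at this
    simpa using this
  have hinj : Function.Injective (LinearMap.inr ℝ ℝ V ∘ₗ K.subtype) := by
    rw [LinearMap.coe_comp]
    exact LinearMap.inr_injective.comp K.subtype_injective
  have e : solSpace B J x₀ G t =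
      Submodule.map (LinearMap.inr ℝ ℝ V ∘ₗ K.subtype) (LinearMap.ker f) := by
    apply le_antisymm
    · rintro ⟨c, q⟩ ⟨h1, h2⟩
      simp only at h1 h2
      have hc : c = 0 := by
        by_contra hc
        refine hx ⟨(c * t)⁻¹ • q, ?_⟩
        rw [map_smul, h1, smul_smul, inv_mul_cancel₀ (mul_ne_zero hc ht), one_smul]
      subst hc
      simp only [zero_mul, zero_smul] at h1 h2
      exact ⟨⟨q, h1⟩, h2.symm, rfl⟩
    · rintro _ ⟨⟨q, hq⟩, hqf, rfl⟩
      have hqf' : B (J x₀) q = 0 := hqf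
      have hq' : expSub J t q = 0 := hq
      exact ⟨by simp [hq'], by simp [hqf']⟩
  rw [e, ← (Submodule.equivMapOfInjective _ hinj _).finrank_eq]
  exact Module.Dual.finrank_ker_add_one_of_ne_zero hf

/-- `J` commutes with `e^{-tJ} - I`, so `J x₀` lies in the range along with `x₀`, and the range is
orthogonal to the kernel. -/
lemma form_apply_apply_eq_zero (hskew : ∀ x y, B (J x) y = - B x (J y)) (ht : t ≠ 0) {v k : V}
    (hv : expSub J t v = t • x₀) (hk : k ∈ LinearMap.ker (expSub J t)) : B (J x₀) k = 0 := by
  refine form_apply_eq_zero_of_mem_range_expSub B hskew ⟨t⁻¹ • J v, ?_⟩ hk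
  rw [map_smul, ← apply_expSub, hv, map_smul, smul_smul, inv_mul_cancel₀ ht, one_smul]

/-- The second condition holds at `(1, v)` and on the kernel, so the solutions are exactly the pairs
`(c, c v + k)` with `k` in the kernel. -/
lemma finrank_solSpace_of_eq (hskew : ∀ x y, B (J x) y = - B x (J y)) (ht : t ≠ 0) {v : V}
    (hv : expSub J t v = t • x₀) (hG : B (J x₀) v = G) :
    Module.finrank ℝ (solSpace B J x₀ G t) =
      Module.finrank ℝ (LinearMap.ker (expSub J t)) + 1 := by
  set K := LinearMap.ker (expSub J t) with hK
  let L : ℝ × K →ₗ[ℝ] ℝ × V :=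
    (LinearMap.fst ℝ ℝ K).prod (LinearMap.coprod (LinearMap.toSpanSingleton ℝ V v) K.subtype)
  have hL (c : ℝ) (k : K) : L (c, k) = (c, c • v + k) := by simp [L]
  have hinj : Function.Injective L := by
    rintro ⟨c, k⟩ ⟨c', k'⟩ h
    rw [hL, hL, Prod.mk.injEq] at h
    obtain ⟨rfl, h⟩ := h
    rw [Prod.mk.injEq]
    exact ⟨rfl, Subtype.ext (add_left_cancel h)⟩
  have e : solSpace B J x₀ G t = LinearMap.range L := by
    apply le_antisymm
    · rintro ⟨c, q⟩ ⟨h1, h2⟩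
      simp only at h1 h2
      refine ⟨(c, ⟨q - c • v, ?_⟩), ?_⟩
      · rw [LinearMap.mem_ker, map_sub, map_smul, h1, hv, smul_smul, sub_self]
      · simp [hL]
    · rintro _ ⟨⟨c, k⟩, rfl⟩
      rw [hL, mem_solSpace]
      have hk : expSub J t (k : V) = 0 := k.2
      constructor
      · rw [map_add, map_smul, hv, hk, add_zero, smul_smul]
      · rw [map_add, map_smul, hG, form_apply_apply_eq_zero hskew ht hv k.2, add_zero, smul_eq_mul]
  rw [e, LinearMap.finrank_range_of_inj hinj, Module.finrank_prod, Module.finrank_self, add_comm]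

/-- Writing `q = c v + k`, the second condition reads `c (G - B (J x₀) v) = 0`, so `c = 0` and only
the kernel is left. -/
lemma finrank_solSpace_of_ne (hskew : ∀ x y, B (J x) y = - B x (J y)) (ht : t ≠ 0) {v : V}
    (hv : expSub J t v = t • x₀) (hG : B (J x₀) v ≠ G) :
    Module.finrank ℝ (solSpace B J x₀ G t) =
      Module.finrank ℝ (LinearMap.ker (expSub J t)) := by
  set K := LinearMap.ker (expSub J t) with hK
  have hinj : Function.Injective (LinearMap.inr ℝ ℝ V ∘ₗ K.subtype) := by
    rw [LinearMap.coe_comp]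
    exact LinearMap.inr_injective.comp K.subtype_injective
  have e : solSpace B J x₀ G t = LinearMap.range (LinearMap.inr ℝ ℝ V ∘ₗ K.subtype) := by
    apply le_antisymm
    · rintro ⟨c, q⟩ ⟨h1, h2⟩
      simp only at h1 h2
      have hk : q - c • v ∈ K := by
        rw [LinearMap.mem_ker, map_sub, map_smul, h1, hv, smul_smul, sub_self]
      have hf := form_apply_apply_eq_zero hskew ht hv hk
      rw [map_sub, map_smul, ← h2, smul_eq_mul, ← mul_sub, mul_eq_zero, sub_eq_zero] at hf
      obtain rfl : c = 0 := hf.resolve_right fun h => hG h.symm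
      exact ⟨⟨q, by simpa using hk⟩, rfl⟩
    · rintro _ ⟨k, rfl⟩
      have hk : expSub J t (k : V) = 0 := k.2
      exact ⟨by simp [hk], by simpa using (form_apply_apply_eq_zero hskew ht hv k.2).symm⟩
  rw [e, LinearMap.finrank_range_of_inj hinj]

end Counting

/-! ### The reduced Jacobi equation when the velocity has a central component -/

section ReducedEquation

variable {V : Type*} [AddCommGroup V] [Module ℝ V] [FiniteDimensional ℝ V]

/-- The equation satisfied by the central component `a` and the orthogonal component `b` of a Jacobi
field along a geodesic whose velocity has components `k` and `x`; here `ε` is the square of the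
generator of the center. -/
def ReducedJacobi (B : LinearMap.BilinForm ℝ V) (j : Module.End ℝ V) (ε k : ℝ) (x : ℝ → V)
    (a : ℝ → ℝ) (b : ℝ → V) : Prop :=
  ∃ (a' : ℝ → ℝ) (b' : ℝ → V), (∀ t, HasDerivAt a (a' t) t) ∧ (∀ t, HasWeakDerivAt b (b' t) t) ∧
    (∀ t, HasDerivAt (fun s => a' s + B (j (x s)) (b s) / ε) 0 t) ∧
    ∀ t, HasWeakDerivAt b' (k • j (b' t) + (a' t + B (j (x t)) (b t) / ε) • j (x t)) t

lemma eq_const_of_hasDerivAt_zero {f : ℝ → ℝ} (hf : ∀ t, HasDerivAt f 0 t) (s : ℝ) : f s = f 0 :=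
  is_const_of_deriv_eq_zero (fun t => (hf t).differentiableAt) (fun t => (hf t).deriv) s 0

lemma eq_of_hasDerivAt_eq {f h f' : ℝ → ℝ} (hf : ∀ t, HasDerivAt f (f' t) t)
    (hh : ∀ t, HasDerivAt h (f' t) t) (h0 : f 0 = h 0) (s : ℝ) : f s = h s := by
  have := eq_const_of_hasDerivAt_zero (f := fun t => f t - h t)
    (fun t => by simpa using (hf t).fun_sub (hh t)) s
  simpa [h0, sub_eq_zero] using this

omit [FiniteDimensional ℝ V] in
lemma eq_of_hasWeakDerivAt_eq {f h f' : ℝ → V} (hf : ∀ t, HasWeakDerivAt f (f' t) t)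
    (hh : ∀ t, HasWeakDerivAt h (f' t) t) (h0 : f 0 = h 0) (s : ℝ) : f s = h s := by
  have := HasWeakDerivAt.eq_const (f := fun t => f t - h t)
    (fun t => by simpa using (hf t).sub (hh t)) s
  simpa [h0, sub_eq_zero] using this

variable (B : LinearMap.BilinForm ℝ V) (j : Module.End ℝ V) (ε : ℝ) (x₀ : V)

/-- The orthogonal component of a Jacobi field along a geodesic not orthogonal to the center. -/
def orthComponent (p : ℝ × V) (t : ℝ) : V :=
  expEnd (t • j) p.2 - p.2 + (p.1 * t) • expEnd (t • j) x₀

/-- The central component of a Jacobi field along a geodesic not orthogonal to the center. -/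
def centralComponent (p : ℝ × V) (t : ℝ) : ℝ :=
  p.1 * t + (t * B x₀ (j p.2) + B x₀ (expEnd ((-t) • j) p.2) - B x₀ p.2) / ε

lemma orthComponent_zero (p : ℝ × V) : orthComponent j x₀ p 0 = 0 := by simp [orthComponent]

lemma centralComponent_zero (p : ℝ × V) : centralComponent B j ε x₀ p 0 = 0 := by
  simp [centralComponent]

lemma orthComponent_hasWeakDerivAt (p : ℝ × V) (t : ℝ) :
    HasWeakDerivAt (orthComponent j x₀ p) (expEnd (t • j) (j p.2) +
      p.1 • expEnd (t • j) x₀ + (p.1 * t) • expEnd (t • j) (j x₀)) t := by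
  have h1 : HasDerivAt (fun t => p.1 * t) p.1 t := by
    simpa using (hasDerivAt_id t).const_mul p.1
  refine (((expEnd_smul_apply_hasWeakDerivAt j p.2 t).sub (HasWeakDerivAt.const p.2)).add
    (HasWeakDerivAt.smul h1 (expEnd_smul_apply_hasWeakDerivAt j x₀ t))).congr_deriv ?_
  simp only [apply_expEnd]
  module

lemma centralComponent_hasDerivAt (p : ℝ × V) (t : ℝ) :
    HasDerivAt (centralComponent B j ε x₀ p)
      (p.1 + (B x₀ (j p.2) - B x₀ (expEnd ((-t) • j) (j p.2))) / ε) t := by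
  have h1 : HasDerivAt (fun t => p.1 * t) p.1 t := by
    simpa using (hasDerivAt_id t).const_mul p.1
  have h2 : HasDerivAt (fun t => t * B x₀ (j p.2)) (B x₀ (j p.2)) t := by
    simpa using (hasDerivAt_id t).mul_const (B x₀ (j p.2))
  have h3 := (expEnd_neg_hasWeakDerivAt j t) (B x₀ ∘ₗ LinearMap.applyₗ p.2)
  refine (h1.fun_add (((h2.fun_add h3).sub_const (B x₀ p.2)).div_const ε)).congr_deriv ?_
  simp only [LinearMap.comp_apply, LinearMap.applyₗ_apply_apply,
    Module.End.mul_apply, map_neg, apply_expEnd, sub_eq_add_neg]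

lemma orthComponent_weakSmooth (p : ℝ × V) : WeakSmooth (orthComponent j x₀ p) :=
  ((expEnd_apply_weakSmooth j p.2).sub (WeakSmooth.const _)).add
    (WeakSmooth.smul (contDiff_const.mul contDiff_id) (expEnd_apply_weakSmooth j x₀))

lemma centralComponent_contDiff (p : ℝ × V) : ContDiff ℝ ∞ (centralComponent B j ε x₀ p) := by
  have h := expEnd_neg_apply_weakSmooth j p.2 (B x₀)
  exact (contDiff_const.mul contDiff_id).add
    ((((contDiff_id.mul contDiff_const).add h).sub contDiff_const).div_const ε)

variable {B j ε x₀}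

/-- Identifies the parameter `p.1` with the first integral `a' + B (j x) b / ε`. The term of `b`
along `e^{tj} x₀` drops out because `B (j x₀) x₀ = 0`. -/
lemma centralComponent_deriv_add (hskew : ∀ x y, B (j x) y = - B x (j y)) (hsymm : B.IsSymm)
    (p : ℝ × V) (t : ℝ) :
    (p.1 + (B x₀ (j p.2) - B x₀ (expEnd ((-t) • j) (j p.2))) / ε) +
      B (j (expEnd (t • j) x₀)) (orthComponent j x₀ p t) / ε = p.1 := by
  have h0 : B (j x₀) x₀ = 0 := by
    have := hskew x₀ x₀
    rw [hsymm.eq x₀] at this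
    linarith
  have h1 : B (j (expEnd (t • j) x₀)) (orthComponent j x₀ p t) =
      - B x₀ (j p.2) + B x₀ (expEnd ((-t) • j) (j p.2)) := by
    rw [form_expEnd_neg B hskew, orthComponent, map_add, map_sub, map_smul, apply_expEnd,
      form_expEnd_expEnd B hskew, form_expEnd_expEnd B hskew, h0, ← apply_expEnd, hskew, hskew]
    simp
  rw [h1]
  ring

lemma reducedJacobi_components (hskew : ∀ x y, B (j x) y = - B x (j y)) (hsymm : B.IsSymm)
    (p : ℝ × V) : ReducedJacobi B j ε 1 (fun t => expEnd (t • j) x₀)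
      (centralComponent B j ε x₀ p) (orthComponent j x₀ p) := by
  refine ⟨_, _, centralComponent_hasDerivAt B j ε x₀ p, orthComponent_hasWeakDerivAt j x₀ p, ?_, ?_⟩
  · intro t
    simp only [centralComponent_deriv_add hskew hsymm]
    exact hasDerivAt_const t _
  · intro t
    have h1 : HasDerivAt (fun t => p.1 * t) p.1 t := by
      simpa using (hasDerivAt_id t).const_mul p.1
    refine (((expEnd_smul_apply_hasWeakDerivAt j (j p.2) t).add ((HasWeakDerivAt.smul
      (hasDerivAt_const t p.1) (expEnd_smul_apply_hasWeakDerivAt j x₀ t)))).add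
      (HasWeakDerivAt.smul h1 (expEnd_smul_apply_hasWeakDerivAt j (j x₀) t))).congr_deriv ?_
    rw [centralComponent_deriv_add hskew hsymm]
    simp only [map_add, map_smul, apply_expEnd]
    module

lemma exists_components_of_reducedJacobi (hskew : ∀ x y, B (j x) y = - B x (j y))
    (hsymm : B.IsSymm) (hj : Function.Injective j) {a : ℝ → ℝ} {b : ℝ → V}
    (h : ReducedJacobi B j ε 1 (fun t => expEnd (t • j) x₀) a b) (ha : a 0 = 0) (hb : b 0 = 0) :
    ∃ p : ℝ × V, a = centralComponent B j ε x₀ p ∧ b = orthComponent j x₀ p := by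
  obtain ⟨a', b', ha', hb', hw, hb''⟩ := h
  have hc := eq_const_of_hasDerivAt_zero hw
  set c := a' 0 + B (j (expEnd ((0 : ℝ) • j) x₀)) (b 0) / ε with hcdef
  simp only [hc, one_smul] at hb''
  -- Here `q` is the integration constant: `b'' = j b' + c j x` integrates to `b' = j b + c x + j
  -- q`.
  obtain ⟨q, hq⟩ := LinearMap.injective_iff_surjective.1 hj (b' 0 - c • x₀)
  have h1 (t : ℝ) : b' t = j (b t) + c • expEnd (t • j) x₀ + j q := by
    refine eq_of_hasWeakDerivAt_eq
      (h := fun t => j (b t) + c • expEnd (t • j) x₀ + j q) hb'' (fun t => ?_) ?_ t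
    · refine ((((hb' t).map j).add (HasWeakDerivAt.smul (hasDerivAt_const t c)
        (expEnd_smul_apply_hasWeakDerivAt j x₀ t))).add (HasWeakDerivAt.const _)).congr_deriv ?_
      module
    · simp [hb, hq]
  -- Subtracting the resonant term and adding `q` leaves a solution of the homogeneous equation `y'
  -- = j y` with `y 0 = q`.
  have h2 (t : ℝ) : b t - (c * t) • expEnd (t • j) x₀ + q = expEnd (t • j) q := by
    have := eq_expEnd_of_hasWeakDerivAt j
      (y := fun t => b t - (c * t) • expEnd (t • j) x₀ + q) (fun t => by
        have h1' : HasDerivAt (fun t => c * t) c t := by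
          simpa using (hasDerivAt_id t).const_mul c
        refine (((hb' t).sub (HasWeakDerivAt.smul h1'
          (expEnd_smul_apply_hasWeakDerivAt j x₀ t))).add (HasWeakDerivAt.const q)).congr_deriv ?_
        rw [h1]
        simp only [map_add, map_sub, map_smul]
        module) t
    simpa [hb] using this
  have hbq : b = orthComponent j x₀ (c, q) := by
    funext t
    rw [orthComponent, ← h2]
    module
  refine ⟨(c, q), funext fun t => ?_, hbq⟩
  refine eq_of_hasDerivAt_eq ha' (fun t => ?_) (by rw [ha, centralComponent_zero]) t
  refine (centralComponent_hasDerivAt B j ε x₀ (c, q) t).congr_deriv ?_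
  have e1 := hc t
  have e2 := centralComponent_deriv_add (ε := ε) (x₀ := x₀) hskew hsymm (c, q) t
  rw [hbq] at e1
  simp only at e1 e2 ⊢
  linarith

/-- The parameters can be read off at time `0`: `a' 0 = c` and `b' 0 = j q + c x₀`. -/
lemma eq_zero_of_components_eq_zero (hj : Function.Injective j) {p : ℝ × V}
    (ha : ∀ t, centralComponent B j ε x₀ p t = 0) (hb : ∀ t, orthComponent j x₀ p t = 0) :
    p = 0 := by
  have h1 := (centralComponent_hasDerivAt B j ε x₀ p 0).unique
    (by rw [funext ha]; exact hasDerivAt_const _ _)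
  have h2 := (orthComponent_hasWeakDerivAt j x₀ p 0).unique
    (by rw [funext hb]; exact HasWeakDerivAt.const _)
  simp only [neg_zero, zero_smul, expEnd_zero, Module.End.one_apply, sub_self, zero_div,
    add_zero, mul_zero] at h1 h2
  rw [h1, zero_smul, add_zero] at h2
  exact Prod.ext h1 (hj (by simpa using h2))

/-- Applying `e^{-tj}` to `b t = 0` gives the first equation of `solSpace`. It allows `e^{-tj} q` to
be replaced by `q + c t x₀` in `a t`, which then equals `t / ε` times the defect of the second
equation. -/
lemma components_eq_zero_iff (hskew : ∀ x y, B (j x) y = - B x (j y)) (hε : ε ≠ 0)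
    {t : ℝ} (ht : t ≠ 0) (p : ℝ × V) :
    centralComponent B j ε x₀ p t = 0 ∧ orthComponent j x₀ p t = 0 ↔
      p ∈ solSpace B j x₀ (ε + B x₀ x₀) t := by
  have hb : orthComponent j x₀ p t = 0 ↔ expSub j t p.2 = (p.1 * t) • x₀ := by
    have e : orthComponent j x₀ p t = - expEnd (t • j) (expSub j t p.2 - (p.1 * t) • x₀) := by
      rw [map_sub, map_smul, expSub, LinearMap.sub_apply, map_sub, expEnd_apply_expEnd_neg,
        Module.End.one_apply, orthComponent]
      module
    rw [e, neg_eq_zero]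
    constructor
    · intro h
      rw [← sub_eq_zero, ← expEnd_neg_apply_expEnd j t (expSub j t p.2 - _), h, map_zero]
    · intro h
      rw [h, sub_self, map_zero]
  rw [hb, and_comm]
  refine and_congr_right fun h => ?_
  have e : B x₀ (expEnd ((-t) • j) p.2) = B x₀ p.2 + p.1 * t * B x₀ x₀ := by
    have : expEnd ((-t) • j) p.2 = p.2 + (p.1 * t) • x₀ := by rw [← h]; simp [expSub]
    rw [this]
    simp
  rw [centralComponent, e, hskew]
  have : p.1 * t + (t * B x₀ (j p.2) + (B x₀ p.2 + p.1 * t * B x₀ x₀) - B x₀ p.2) / ε =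
      t / ε * (p.1 * (ε + B x₀ x₀) + B x₀ (j p.2)) := by
    field_simp
    ring
  rw [this, mul_eq_zero, or_iff_right (div_ne_zero ht hε), add_eq_zero_iff_eq_neg]

end ReducedEquation

/-! ### The reduced Jacobi equation when the velocity is orthogonal to the center -/

section HorizontalEquation

variable {V : Type*} [AddCommGroup V] [Module ℝ V] [FiniteDimensional ℝ V]
  (B : LinearMap.BilinForm ℝ V) (j : Module.End ℝ V) (ε : ℝ) (x₀ : V)

/-- The orthogonal component of a Jacobi field along a geodesic orthogonal to the center. -/
def horizontalOrthComponent (p : ℝ × V) (t : ℝ) : V :=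
  t • p.2 + (p.1 * t ^ 2 / 2) • j x₀

/-- The central component of a Jacobi field along a geodesic orthogonal to the center. -/
def horizontalCentralComponent (p : ℝ × V) (t : ℝ) : ℝ :=
  p.1 * t - (t ^ 2 / 2 * B (j x₀) p.2 + p.1 * t ^ 3 / 6 * B (j x₀) (j x₀)) / ε

omit [FiniteDimensional ℝ V] in
lemma horizontalOrthComponent_hasWeakDerivAt (p : ℝ × V) (t : ℝ) :
    HasWeakDerivAt (horizontalOrthComponent j x₀ p) (p.2 + (p.1 * t) • j x₀) t := by
  have h : HasDerivAt (fun t => p.1 * t ^ 2 / 2) (p.1 * t) t := by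
    refine (((hasDerivAt_pow 2 t).const_mul p.1).div_const 2).congr_deriv ?_
    simp
    ring
  refine ((HasWeakDerivAt.smul_const (hasDerivAt_id t) p.2).add
    (HasWeakDerivAt.smul_const h (j x₀))).congr_deriv ?_
  simp

omit [FiniteDimensional ℝ V] in
lemma horizontalCentralComponent_hasDerivAt (p : ℝ × V) (t : ℝ) :
    HasDerivAt (horizontalCentralComponent B j ε x₀ p)
      (p.1 - B (j x₀) (horizontalOrthComponent j x₀ p t) / ε) t := by
  have h1 : HasDerivAt (fun t => p.1 * t) p.1 t := by
    simpa using (hasDerivAt_id t).const_mul p.1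
  have h2 := ((hasDerivAt_pow 2 t).div_const 2).mul_const (B (j x₀) p.2)
  have h3 := (((hasDerivAt_pow 3 t).const_mul p.1).div_const 6).mul_const (B (j x₀) (j x₀))
  refine (h1.fun_sub ((h2.fun_add h3).div_const ε)).congr_deriv ?_
  simp [horizontalOrthComponent]
  ring

omit [FiniteDimensional ℝ V] in
lemma horizontalOrthComponent_weakSmooth (p : ℝ × V) :
    WeakSmooth (horizontalOrthComponent j x₀ p) :=
  (WeakSmooth.smul contDiff_id (WeakSmooth.const _)).add
    (WeakSmooth.smul (by fun_prop) (WeakSmooth.const _))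

omit [FiniteDimensional ℝ V] in
lemma horizontalCentralComponent_contDiff (p : ℝ × V) :
    ContDiff ℝ ∞ (horizontalCentralComponent B j ε x₀ p) := by
  unfold horizontalCentralComponent
  fun_prop

variable {B j ε x₀}

omit [FiniteDimensional ℝ V] in
lemma reducedJacobi_horizontal (p : ℝ × V) : ReducedJacobi B j ε 0 (fun _ => x₀)
    (horizontalCentralComponent B j ε x₀ p) (horizontalOrthComponent j x₀ p) := by
  refine ⟨_, _, horizontalCentralComponent_hasDerivAt B j ε x₀ p,
    horizontalOrthComponent_hasWeakDerivAt j x₀ p, ?_, ?_⟩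
  · intro t
    simp only [sub_add_cancel]
    exact hasDerivAt_const t _
  · intro t
    have h1 : HasDerivAt (fun t => p.1 * t) p.1 t := by
      simpa using (hasDerivAt_id t).const_mul p.1
    refine ((HasWeakDerivAt.const p.2).add (HasWeakDerivAt.smul_const h1 (j x₀))).congr_deriv ?_
    rw [sub_add_cancel]
    module

omit [FiniteDimensional ℝ V] in
lemma exists_horizontal_of_reducedJacobi {a : ℝ → ℝ} {b : ℝ → V}
    (h : ReducedJacobi B j ε 0 (fun _ => x₀) a b) (ha : a 0 = 0) (hb : b 0 = 0) :
    ∃ p : ℝ × V, a = horizontalCentralComponent B j ε x₀ p ∧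
      b = horizontalOrthComponent j x₀ p := by
  obtain ⟨a', b', ha', hb', hw, hb''⟩ := h
  have hc := eq_const_of_hasDerivAt_zero hw
  set c := a' 0 + B (j x₀) (b 0) / ε with hcdef
  simp only [hc, zero_smul, zero_add] at hb''
  have h1 (t : ℝ) : b' t = b' 0 + (c * t) • j x₀ := by
    refine eq_of_hasWeakDerivAt_eq (h := fun t => b' 0 + (c * t) • j x₀) hb''
      (fun t => ?_) (by simp) t
    have h1 : HasDerivAt (fun t => c * t) c t := by
      simpa using (hasDerivAt_id t).const_mul c
    refine ((HasWeakDerivAt.const _).add (HasWeakDerivAt.smul_const h1 (j x₀))).congr_deriv ?_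
    module
  have hbq : b = horizontalOrthComponent j x₀ (c, b' 0) := by
    funext t
    refine eq_of_hasWeakDerivAt_eq (h := horizontalOrthComponent j x₀ (c, b' 0)) hb'
      (fun t => ?_) (by simp [hb, horizontalOrthComponent]) t
    exact (horizontalOrthComponent_hasWeakDerivAt j x₀ _ t).congr_deriv (h1 t).symm
  refine ⟨(c, b' 0), funext fun t => ?_, hbq⟩
  refine eq_of_hasDerivAt_eq ha' (fun t => ?_) (by simp [ha, horizontalCentralComponent]) t
  refine (horizontalCentralComponent_hasDerivAt B j ε x₀ _ t).congr_deriv ?_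
  have e1 := hc t
  rw [hbq] at e1
  simp only at e1 ⊢
  linarith

omit [FiniteDimensional ℝ V] in
lemma eq_zero_of_horizontal_eq_zero {p : ℝ × V}
    (ha : ∀ t, horizontalCentralComponent B j ε x₀ p t = 0)
    (hb : ∀ t, horizontalOrthComponent j x₀ p t = 0) : p = 0 := by
  have h1 := (horizontalCentralComponent_hasDerivAt B j ε x₀ p 0).unique
    (by rw [funext ha]; exact hasDerivAt_const _ _)
  have h2 := (horizontalOrthComponent_hasWeakDerivAt j x₀ p 0).unique
    (by rw [funext hb]; exact HasWeakDerivAt.const _)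
  rw [hb] at h1
  simp only [map_zero, zero_div, sub_zero] at h1
  exact Prod.ext h1 (by simpa using h2)

omit [FiniteDimensional ℝ V] in
lemma horizontal_eq_zero_iff (hε : ε ≠ 0) {t : ℝ} (ht : t ≠ 0) (p : ℝ × V) :
    horizontalCentralComponent B j ε x₀ p t = 0 ∧ horizontalOrthComponent j x₀ p t = 0 ↔
      p.2 = (-(p.1 * t / 2)) • j x₀ ∧ (p.1 = 0 ∨ B (j x₀) (j x₀) = -12 * ε / t ^ 2) := by
  have hb : horizontalOrthComponent j x₀ p t = 0 ↔ p.2 = (-(p.1 * t / 2)) • j x₀ := by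
    have e : horizontalOrthComponent j x₀ p t = t • (p.2 - (-(p.1 * t / 2)) • j x₀) := by
      rw [horizontalOrthComponent]
      module
    rw [e, smul_eq_zero, or_iff_right ht, sub_eq_zero]
  rw [hb, and_comm]
  refine and_congr_right fun h => ?_
  rw [horizontalCentralComponent, h]
  -- With `q = -(c t / 2) j x₀` the cubic terms have coefficients `1/4` and `-1/6`; their sum `1/12`
  -- is the source of the constant `12`.
  have : p.1 * t - (t ^ 2 / 2 * B (j x₀) ((-(p.1 * t / 2)) • j x₀) +
      p.1 * t ^ 3 / 6 * B (j x₀) (j x₀)) / ε =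
      p.1 * (t ^ 3 / (12 * ε) * (B (j x₀) (j x₀) - -12 * ε / t ^ 2)) := by
    rw [map_smul, smul_eq_mul]
    field_simp
    ring
  rw [this, mul_eq_zero, mul_eq_zero, or_iff_right (a := t ^ 3 / (12 * ε) = 0) (by positivity),
    sub_eq_zero]

end HorizontalEquation

/-! ### Two-step nilpotent algebras with nondegenerate one-dimensional center -/

section TwoStepAlgebra

variable {𝔫 : Type*} [LieRing 𝔫] [LieAlgebra ℝ 𝔫] {g : ScalarProduct 𝔫}

lemma lie_eq_zero_of_mem_center {c : 𝔫} (hc : c ∈ centerSpace 𝔫) (x : 𝔫) : ⁅x, c⁆ = 0 :=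
  (LieModule.mem_maxTrivSubmodule ℝ 𝔫 𝔫 c).1 hc x

lemma center_lie_eq_zero {c : 𝔫} (hc : c ∈ centerSpace 𝔫) (x : 𝔫) : ⁅c, x⁆ = 0 := by
  rw [← lie_skew, lie_eq_zero_of_mem_center hc, neg_zero]

lemma exists_smul_eq_of_finrank_center (hdim : Module.finrank ℝ (centerSpace 𝔫) = 1)
    {e : centerSpace 𝔫} (he : e ≠ 0) (z : centerSpace 𝔫) : ∃ r : ℝ, r • e = z :=
  (finrank_eq_one_iff_of_nonzero' e he).1 hdim z

lemma form_self_ne_zero (hZ : g.CenterNondegenerate)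
    (hdim : Module.finrank ℝ (centerSpace 𝔫) = 1) {e : centerSpace 𝔫} (he : e ≠ 0) :
    g.form e e ≠ 0 := by
  intro h
  refine he (hZ.1 e fun z => ?_)
  obtain ⟨r, rfl⟩ := exists_smul_eq_of_finrank_center hdim he z
  simp [h]

lemma form_vSpace_eq_zero {c : 𝔫} (hc : c ∈ centerSpace 𝔫) (v : g.vSpace) : g.form c v = 0 :=
  v.2 c hc

variable (g) in
/-- The coordinate of the central component with respect to a generator of the center. -/
def centralCoord (e : centerSpace 𝔫) : 𝔫 →ₗ[ℝ] ℝ := (g.form e e)⁻¹ • g.form e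

lemma centralCoord_apply (e : centerSpace 𝔫) (y : 𝔫) :
    centralCoord g e y = g.form e y / g.form e e := by
  simp [centralCoord, div_eq_inv_mul]

variable (g) in
/-- A generator of a nondegenerate one-dimensional center. -/
structure IsGenerator (e : centerSpace 𝔫) : Prop where
  form_ne : g.form e e ≠ 0
  span (z : centerSpace 𝔫) : ∃ r : ℝ, r • e = z

lemma isGenerator_of_ne_zero (hZ : g.CenterNondegenerate)
    (hdim : Module.finrank ℝ (centerSpace 𝔫) = 1) {e : centerSpace 𝔫} (he : e ≠ 0) :
    IsGenerator g e :=
  ⟨form_self_ne_zero hZ hdim he, exists_smul_eq_of_finrank_center hdim he⟩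

namespace IsGenerator

variable {e : centerSpace 𝔫} (he : IsGenerator g e)

/-- The orthogonal projection to the orthogonal complement of the center. -/
def proj : 𝔫 →ₗ[ℝ] g.vSpace :=
  (LinearMap.id - (centralCoord g e).smulRight (e : 𝔫)).codRestrict g.vSpace (by
    intro y c hc
    obtain ⟨r, hr⟩ := he.span ⟨c, hc⟩
    obtain rfl : r • (e : 𝔫) = c := congrArg Subtype.val hr
    have := he.form_ne
    change g.form (r • (e : 𝔫)) (y - centralCoord g e y • (e : 𝔫)) = 0
    simp only [centralCoord_apply, map_smul, map_sub, LinearMap.smul_apply, smul_eq_mul]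
    field_simp
    ring)

lemma proj_coe (y : 𝔫) : (he.proj y : 𝔫) = y - centralCoord g e y • (e : 𝔫) := rfl

lemma decomp (y : 𝔫) : centralCoord g e y • (e : 𝔫) + he.proj y = y := by
  rw [proj_coe]; abel

lemma centralCoord_vSpace (v : g.vSpace) : centralCoord g e v = 0 := by
  rw [centralCoord_apply, form_vSpace_eq_zero e.2, zero_div]

lemma centralCoord_self (he : IsGenerator g e) : centralCoord g e e = 1 := by
  rw [centralCoord_apply, div_self he.form_ne]

lemma proj_self : he.proj e = 0 := by
  apply Subtype.ext
  rw [proj_coe, he.centralCoord_self, one_smul, sub_self]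
  rfl

lemma proj_vSpace (v : g.vSpace) : he.proj v = v := by
  apply Subtype.ext
  rw [proj_coe, centralCoord_vSpace, zero_smul, sub_zero]

lemma eq_smul_of_mem_center (he : IsGenerator g e) {c : 𝔫} (hc : c ∈ centerSpace 𝔫) :
    c = centralCoord g e c • (e : 𝔫) := by
  obtain ⟨r, hr⟩ := he.span ⟨c, hc⟩
  obtain rfl : r • (e : 𝔫) = c := congrArg Subtype.val hr
  rw [map_smul, he.centralCoord_self, smul_eq_mul, mul_one]

lemma proj_of_mem_center {c : 𝔫} (hc : c ∈ centerSpace 𝔫) : he.proj c = 0 := by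
  rw [he.eq_smul_of_mem_center hc, map_smul, he.proj_self, smul_zero]

lemma form_coe_vSpace (v : g.vSpace) (y : 𝔫) :
    g.form v y = g.form v (he.proj y) := by
  conv_lhs => rw [← he.decomp y]
  rw [map_add, map_smul, g.symm.eq v e, form_vSpace_eq_zero e.2, smul_zero, zero_add]

lemma lie_proj (x y : 𝔫) : ⁅(he.proj x : 𝔫), y⁆ = ⁅x, y⁆ := by
  conv_rhs => rw [← he.decomp x]
  rw [add_lie, smul_lie, center_lie_eq_zero e.2, smul_zero, zero_add]

lemma form_self_eq (y : 𝔫) : g.form y y = centralCoord g e y ^ 2 * g.form e e +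
    g.form (he.proj y) (he.proj y) := by
  conv_lhs => rw [← he.decomp y]
  simp only [map_add, LinearMap.add_apply, map_smul, LinearMap.smul_apply, smul_eq_mul,
    form_vSpace_eq_zero e.2, g.symm.eq _ (e : 𝔫)]
  ring

end IsGenerator

variable [FiniteDimensional ℝ 𝔫]

lemma form_J (z : centerSpace 𝔫) (x : g.vSpace) (y : 𝔫) :
    g.form (g.J z x) y = g.form z ⁅(x : 𝔫), y⁆ :=
  g.form_adDagger x z y

lemma form_J_skew (z : centerSpace 𝔫) (x y : g.vSpace) :
    g.form.restrict g.vSpace (g.J z x) y = - g.form.restrict g.vSpace x (g.J z y) := by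
  change g.form (g.J z x) y = - g.form x (g.J z y)
  rw [g.symm.eq x, form_J, form_J, ← lie_skew, map_neg]

omit [FiniteDimensional ℝ 𝔫] in
lemma form_restrict_isSymm : (g.form.restrict g.vSpace).IsSymm :=
  ⟨fun x y => g.symm.eq (x : 𝔫) y⟩

namespace IsGenerator

variable {e : centerSpace 𝔫} (he : IsGenerator g e)

omit [FiniteDimensional ℝ 𝔫] in
lemma form_restrict_nondegenerate (he : IsGenerator g e) :
    (g.form.restrict g.vSpace).Nondegenerate := by
  have h (x : g.vSpace) (hx : ∀ y : g.vSpace, g.form x y = 0) : x = 0 := by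
    refine Subtype.ext (g.ext_form fun y => ?_)
    rw [he.form_coe_vSpace, hx]
    simp
  exact ⟨fun x hx => h x fun y => hx y, fun x hx => h x fun y => by
    rw [g.symm.eq]; exact hx y⟩

lemma centralCoord_lie (x y : 𝔫) : centralCoord g e ⁅x, y⁆ =
    g.form.restrict g.vSpace (g.J e (he.proj x)) (he.proj y) / g.form e e := by
  change _ = g.form (g.J e (he.proj x)) (he.proj y) / g.form e e
  rw [← he.form_coe_vSpace, form_J, he.lie_proj, centralCoord_apply]

/-- All brackets are multiples of `e`, so `⟨w, [y, s]⟩` sees only the central coordinate of `w`, and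
`[y, s]` only the orthogonal part of `y`. -/
lemma adDagger_eq (h2 : ∀ x y : 𝔫, ⁅x, y⁆ ∈ centerSpace 𝔫) (y w : 𝔫) :
    g.adDagger y w = centralCoord g e w • (g.J e (he.proj y) : 𝔫) := by
  apply g.ext_form
  intro s
  rw [g.form_adDagger, map_smul, LinearMap.smul_apply, form_J, he.lie_proj]
  rw [he.eq_smul_of_mem_center (h2 y s), map_smul, map_smul, g.symm.eq w, centralCoord_apply _ w]
  have := he.form_ne
  simp only [smul_eq_mul]
  field_simp

/-- If `J_e x = 0`, every bracket with `x` is a multiple of `e` orthogonal to `e`, hence zero; so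
`x` is central as well as orthogonal to the center. -/
lemma J_injective (he : IsGenerator g e) (h2 : ∀ x y : 𝔫, ⁅x, y⁆ ∈ centerSpace 𝔫) :
    Function.Injective (g.J e) := by
  rw [injective_iff_map_eq_zero]
  intro x hx
  have hz (y : 𝔫) : ⁅(x : 𝔫), y⁆ = 0 := by
    rw [he.eq_smul_of_mem_center (h2 _ _), centralCoord_apply, ← form_J, hx]
    simp
  have hc : (x : 𝔫) ∈ centerSpace 𝔫 := (LieModule.mem_maxTrivSubmodule ℝ 𝔫 𝔫 _).2 fun y => by
    rw [← lie_skew, hz, neg_zero]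
  rw [← he.proj_vSpace x, he.proj_of_mem_center hc]

end IsGenerator

/-- The Jacobi equation in a left-invariant frame: the linearization of `u' = ad†_u u` in the
direction `w = y' + [u, y]`. -/
def IsAlgebraicJacobi (g : ScalarProduct 𝔫) (u y : ℝ → 𝔫) : Prop :=
  WeakSmooth y ∧ ∃ y' : ℝ → 𝔫, (∀ t, HasWeakDerivAt y (y' t) t) ∧
    ∀ t, HasWeakDerivAt (fun s => y' s + ⁅u s, y s⁆)
      (g.adDagger (y' t + ⁅u t, y t⁆) (u t) + g.adDagger (u t) (y' t + ⁅u t, y t⁆)) t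

namespace IsGenerator

variable {e : centerSpace 𝔫} (he : IsGenerator g e)

/-- Project the equation for `w = y' + [u, y]` to the center and to its complement. By `adDagger_eq`
the right side has no central part, so the central coordinate of `w` is constant; the bracket is
central, so the orthogonal part of `w` is `b'`. -/
lemma isAlgebraicJacobi_iff (h2 : ∀ x y : 𝔫, ⁅x, y⁆ ∈ centerSpace 𝔫) {u y : ℝ → 𝔫} {k : ℝ}
    (hk : ∀ t, centralCoord g e (u t) = k) :
    IsAlgebraicJacobi g u y ↔ WeakSmooth y ∧
      ReducedJacobi (g.form.restrict g.vSpace) (g.J e) (g.form e e) k (fun t => he.proj (u t))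
        (fun t => centralCoord g e (y t)) (fun t => he.proj (y t)) := by
  refine and_congr_right fun _ => ⟨?_, ?_⟩
  · rintro ⟨y', hy', hw⟩
    refine ⟨fun t => centralCoord g e (y' t), fun t => he.proj (y' t),
      fun t => hy' t (centralCoord g e), fun t => (hy' t).map he.proj, fun t => ?_, fun t => ?_⟩
    · have := hw t (centralCoord g e)
      simp only [he.adDagger_eq h2, map_add, map_smul, centralCoord_vSpace, smul_zero,
        add_zero, he.centralCoord_lie] at this
      exact this
    · have := (hw t).map he.proj
      simp only [he.adDagger_eq h2, map_add, map_smul, he.proj_of_mem_center (h2 _ _), hk,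
        add_zero, he.proj_vSpace, he.centralCoord_lie] at this
      exact this
  · rintro ⟨a', b', ha', hb', hc, hb''⟩
    have hy' (t : ℝ) : HasWeakDerivAt y (a' t • (e : 𝔫) + b' t) t := by
      have := (HasWeakDerivAt.smul_const (ha' t) (e : 𝔫)).add ((hb' t).map g.vSpace.subtype)
      simpa only [Submodule.subtype_apply, he.decomp] using this
    refine ⟨_, hy', fun t => ?_⟩
    have hκ (t : ℝ) : centralCoord g e (a' t • (e : 𝔫) + b' t + ⁅u t, y t⁆) = a' t +
        g.form.restrict g.vSpace (g.J e (he.proj (u t))) (he.proj (y t)) / g.form e e := by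
      rw [map_add, map_add, map_smul, he.centralCoord_self, centralCoord_vSpace,
        he.centralCoord_lie, smul_eq_mul, mul_one, add_zero]
    have hπ (t : ℝ) : he.proj (a' t • (e : 𝔫) + b' t + ⁅u t, y t⁆) = b' t := by
      rw [map_add, map_add, map_smul, he.proj_self, smul_zero, zero_add, he.proj_vSpace,
        he.proj_of_mem_center (h2 _ _), add_zero]
    have := (HasWeakDerivAt.smul_const (hc t) (e : 𝔫)).add ((hb'' t).map g.vSpace.subtype)
    simp only [he.adDagger_eq h2, hκ, hπ, hk]
    simp only [← hκ, Submodule.subtype_apply, zero_smul, zero_add] at this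
    have hs (s : ℝ) : a' s • (e : 𝔫) + b' s + ⁅u s, y s⁆ =
        centralCoord g e (a' s • (e : 𝔫) + b' s + ⁅u s, y s⁆) • (e : 𝔫) + b' s := by
      conv_lhs => rw [← he.decomp (a' s • (e : 𝔫) + b' s + ⁅u s, y s⁆), hπ]
    rw [funext hs, ← hκ]
    exact this

end IsGenerator

end TwoStepAlgebra

/-! ### Weak and normed calculus agree in finite dimension -/

section NormedBridge

variable {E : Type*} [NormedAddCommGroup E] [NormedSpace ℝ E] [FiniteDimensional ℝ E]

lemma contDiff_iff_weakSmooth (f : ℝ → E) : ContDiff ℝ ∞ f ↔ WeakSmooth f := by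
  constructor
  · exact fun h φ => (LinearMap.toContinuousLinearMap φ).contDiff.comp h
  · intro h
    set b := Module.finBasis ℝ E
    have : f = fun t => ∑ i, b.coord i (f t) • b i := by
      funext t
      exact (b.sum_repr (f t)).symm
    rw [this]
    exact ContDiff.sum fun i _ => (h (b.coord i)).smul contDiff_const

lemma hasDerivAt_of_hasWeakDerivAt {f : ℝ → E} {f' : E} {t : ℝ} (h : HasWeakDerivAt f f' t) :
    HasDerivAt f f' t := by
  set b := Module.finBasis ℝ E
  have e (v : E) : ∑ i, b.coord i v • b i = v := b.sum_repr v
  have := HasDerivAt.fun_sum (u := Finset.univ) fun i _ => (h (b.coord i)).smul_const (b i)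
  simpa only [e] using this

end NormedBridge

/-! ### Curves in the group seen in a left-invariant frame -/

section Geometry

variable {E : Type*} [NormedAddCommGroup E] [NormedSpace ℝ E]
  {N : Type*} [TopologicalSpace N] [ChartedSpace E N] [Group N] [LieGroup 𝓘(ℝ, E) ∞ N]

omit [Group N] [LieGroup 𝓘(ℝ, E) ∞ N] in
lemma inTangentCoordinates_of_const [IsManifold 𝓘(ℝ, E) 1 N] (c : ℝ → N) (p : N)
    (hc : ∀ t, c t = p) (ϕ : ℝ → ℝ →L[ℝ] E) (t₀ : ℝ) :
    inTangentCoordinates 𝓘(ℝ, ℝ) 𝓘(ℝ, E) (fun t : ℝ => t) c ϕ t₀ = ϕ := by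
  funext t
  obtain rfl : c = fun _ => p := funext hc
  rw [inTangentCoordinates_eq _ _ _ (mem_chart_source ℝ t) (mem_chart_source E p)]
  ext
  have h1 : (tangentBundleCore 𝓘(ℝ, ℝ) ℝ).coordChange (achart ℝ t₀) (achart ℝ t) t (1 : ℝ) = 1 :=
    (tangentBundleCore 𝓘(ℝ, ℝ) ℝ).coordChange_self (achart ℝ t) t (mem_chart_source ℝ t) 1
  simp only [ContinuousLinearMap.comp_apply]
  rw [h1]
  exact (tangentBundleCore 𝓘(ℝ, E) N).coordChange_self (achart E p) p (mem_chart_source E p) _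

/-- The body velocity at `t` is the derivative at `s = t` of `(γ t)⁻¹ * γ s`, a smooth function of
`(t, s)`. All these derivatives are based at the fixed point `1`, so the tangent coordinates are
constant in `t`. -/
lemma contDiff_leftTriv_velocity {γ : ℝ → N} (hγ : ContMDiff 𝓘(ℝ, ℝ) 𝓘(ℝ, E) ∞ γ) :
    ContDiff ℝ ∞ (F := E) (fun t => leftTriv (γ t) (velocity γ t)) := by
  refine contDiff_iff_contDiffAt.2 fun t₀ => ?_
  have hF : ContMDiff (𝓘(ℝ, ℝ).prod 𝓘(ℝ, ℝ)) 𝓘(ℝ, E) ∞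
      (Function.uncurry fun t s : ℝ => (γ t)⁻¹ * γ s) :=
    ((hγ.comp contMDiff_fst).inv).mul (hγ.comp contMDiff_snd)
  let ϕ : ℝ → ℝ →L[ℝ] E := fun t =>
    mfderiv 𝓘(ℝ, ℝ) 𝓘(ℝ, E) (fun s : ℝ => (γ t)⁻¹ * γ s) t
  have h : ContMDiffAt 𝓘(ℝ, ℝ) 𝓘(ℝ, ℝ →L[ℝ] E) ∞ (inTangentCoordinates 𝓘(ℝ, ℝ) 𝓘(ℝ, E)
      (fun t : ℝ => t) (fun t => (γ t)⁻¹ * γ t) ϕ t₀) t₀ :=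
    ContMDiffAt.mfderiv (x₀ := t₀) (m := ∞) (fun t s : ℝ => (γ t)⁻¹ * γ s) (fun t => t)
      hF.contMDiffAt contMDiffAt_id (by simp)
  have : IsManifold 𝓘(ℝ, E) 1 N := IsManifold.of_le (n := ∞) (by simp)
  rw [inTangentCoordinates_of_const _ 1 (fun t => inv_mul_cancel _)] at h
  have h3 : ContDiffAt ℝ ∞ (fun t => ϕ t 1) t₀ := h.contDiffAt.clm_apply contDiffAt_const
  refine h3.congr_of_eventuallyEq (Filter.Eventually.of_forall fun t => ?_)
  have h4 : mfderiv 𝓘(ℝ, ℝ) 𝓘(ℝ, E) ((fun q : N => (γ t)⁻¹ * q) ∘ γ) t =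
      (mfderiv 𝓘(ℝ, E) 𝓘(ℝ, E) (fun q : N => (γ t)⁻¹ * q) (γ t)).comp
        (mfderiv 𝓘(ℝ, ℝ) 𝓘(ℝ, E) γ t) :=
    mfderiv_comp (I' := 𝓘(ℝ, E)) t ((contMDiff_mul_left (n := ∞)).mdifferentiable (by simp) _)
      (hγ.mdifferentiable (by simp) t)
  exact (DFunLike.congr_fun h4 (1 : ℝ)).symm

omit [LieGroup 𝓘(ℝ, E) ∞ N] in
lemma leftTriv_add (p : N) (u w : TangentSpace 𝓘(ℝ, E) p) :
    leftTriv p (u + w) = leftTriv p u + leftTriv p w :=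
  map_add (mfderiv 𝓘(ℝ, E) 𝓘(ℝ, E) (fun q : N => p⁻¹ * q) p) u w

omit [LieGroup 𝓘(ℝ, E) ∞ N] in
lemma leftTriv_zero (p : N) : leftTriv p (0 : TangentSpace 𝓘(ℝ, E) p) = 0 :=
  map_zero (mfderiv 𝓘(ℝ, E) 𝓘(ℝ, E) (fun q : N => p⁻¹ * q) p)

lemma leftTriv_injective (p : N) :
    Function.Injective (leftTriv (E := E) p) := fun u w h => by
  rw [← mulInvariantVectorField_leftTriv p u, h, mulInvariantVectorField_leftTriv]

variable [FiniteDimensional ℝ E] {g : ScalarProduct (GroupLieAlgebra 𝓘(ℝ, E) N)}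

omit [LieGroup 𝓘(ℝ, E) ∞ N] in
lemma smoothAlong_iff (γ : ℝ → N) (Y : ∀ t, TangentSpace 𝓘(ℝ, E) (γ t)) :
    SmoothAlong γ Y ↔ WeakSmooth (fun t => leftTriv (γ t) (Y t)) :=
  contDiff_iff_weakSmooth (E := E) _

omit [LieGroup 𝓘(ℝ, E) ∞ N] in
lemma deriv_eq_of_hasWeakDerivAt {f : ℝ → GroupLieAlgebra 𝓘(ℝ, E) N}
    {f' : GroupLieAlgebra 𝓘(ℝ, E) N} {t : ℝ} (h : HasWeakDerivAt f f' t) : deriv f t = f' :=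
  (hasDerivAt_of_hasWeakDerivAt (E := E) (f := f) h).deriv

lemma leftTriv_covDeriv (γ : ℝ → N) (Y : ∀ t, TangentSpace 𝓘(ℝ, E) (γ t)) (t : ℝ) :
    leftTriv (γ t) (covDeriv g γ Y t) =
      deriv (fun s => (leftTriv (γ s) (Y s) : GroupLieAlgebra 𝓘(ℝ, E) N)) t
      + g.nabla (leftTriv (γ t) (velocity γ t)) (leftTriv (γ t) (Y t)) :=
  leftTriv_mulInvariantVectorField _ _

lemma leftTriv_curvature (p : N) (u v w : TangentSpace 𝓘(ℝ, E) p) :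
    leftTriv p (curvature g p u v w) = g.curv (leftTriv p u) (leftTriv p v) (leftTriv p w) :=
  leftTriv_mulInvariantVectorField _ _

end Geometry

/-! ### The covariant Jacobi operator in terms of `ad†` -/

section Connection

variable {𝔫 : Type*} [LieRing 𝔫] [LieAlgebra ℝ 𝔫] [FiniteDimensional ℝ 𝔫]
  (g : ScalarProduct 𝔫)

/-- The Levi-Civita connection on left-invariant fields as a bilinear map. -/
def nablaBilin : 𝔫 →ₗ[ℝ] 𝔫 →ₗ[ℝ] 𝔫 :=
  have hadd (x x' w : 𝔫) : g.adDagger (x + x') w = g.adDagger x w + g.adDagger x' w :=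
    g.ext_form fun s => by simp [g.form_adDagger]
  have hsmul (c : ℝ) (x w : 𝔫) : g.adDagger (c • x) w = c • g.adDagger x w :=
    g.ext_form fun s => by simp [g.form_adDagger]
  LinearMap.mk₂ ℝ g.nabla
    (fun x x' y => by simp only [ScalarProduct.nabla, hadd, add_lie, map_add]; module)
    (fun c x y => by simp only [ScalarProduct.nabla, hsmul, smul_lie, map_smul]; module)
    (fun x y y' => by simp only [ScalarProduct.nabla, hadd, lie_add, map_add]; module)
    (fun c x y => by simp only [ScalarProduct.nabla, hsmul, lie_smul, map_smul]; module)

lemma nablaBilin_apply (x y : 𝔫) : nablaBilin g x y = g.nabla x y := rfl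

/-- The Lie bracket as a bilinear map. -/
def lieBilin (𝔫 : Type*) [LieRing 𝔫] [LieAlgebra ℝ 𝔫] : 𝔫 →ₗ[ℝ] 𝔫 →ₗ[ℝ] 𝔫 :=
  LinearMap.mk₂ ℝ (fun x y => ⁅x, y⁆) add_lie smul_lie lie_add (fun c x y => lie_smul c x y)

/-- The left side is `∇² Y + R(Y, γ')γ'` in the frame, with `u'` replaced by `ad†_u u`; the right
side is `w'` minus the linearization of `ad†_u u`. Once brackets are written through
torsion-freeness and `ad†_a b + ad†_b a = -(∇_a b + ∇_b a)`, both are the same combination of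
iterated `∇`. -/
lemma jacobi_operator_eq (u y y' y'' : 𝔫) :
    (y'' + (g.nabla (g.adDagger u u) y + g.nabla u y') + g.nabla u (y' + g.nabla u y)) +
      g.curv y u u =
    (y'' + (⁅g.adDagger u u, y⁆ + ⁅u, y'⁆)) -
      (g.adDagger (y' + ⁅u, y⁆) u + g.adDagger u (y' + ⁅u, y⁆)) := by
  have hu : g.nabla u u = - g.adDagger u u := by
    rw [ScalarProduct.nabla, lie_self]
    module
  have h1 (a b : 𝔫) : g.adDagger a b + g.adDagger b a = - (g.nabla a b + g.nabla b a) := by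
    rw [ScalarProduct.nabla, ScalarProduct.nabla, ← lie_skew a b]
    module
  rw [h1, ScalarProduct.curv, hu, ← g.nabla_torsion_free _ y, ← g.nabla_torsion_free u y',
    ← g.nabla_torsion_free u y, ← g.nabla_torsion_free y u]
  simp only [← nablaBilin_apply, map_add, map_sub, map_neg, LinearMap.add_apply,
    LinearMap.sub_apply]
  abel

end Connection

/-! ### Geodesics and Jacobi fields as equations in the Lie algebra -/

section JacobiFields

variable {E : Type*} [NormedAddCommGroup E] [NormedSpace ℝ E] [FiniteDimensional ℝ E]
  {N : Type*} [TopologicalSpace N] [ChartedSpace E N] [Group N] [LieGroup 𝓘(ℝ, E) ∞ N]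
  {g : ScalarProduct (GroupLieAlgebra 𝓘(ℝ, E) N)} {γ : ℝ → N}

variable (E) in
/-- The velocity of a curve in a left-invariant frame. -/
def bodyVelocity (γ : ℝ → N) (t : ℝ) : GroupLieAlgebra 𝓘(ℝ, E) N :=
  leftTriv (γ t) (velocity γ t)

namespace IsGeodesic

lemma bodyVelocity_weakSmooth (hγ : IsGeodesic g γ) : WeakSmooth (bodyVelocity E γ) :=
  (contDiff_iff_weakSmooth (E := E) _).1 (contDiff_leftTriv_velocity hγ.1)

lemma bodyVelocity_hasWeakDerivAt (hγ : IsGeodesic g γ) (t : ℝ) :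
    HasWeakDerivAt (bodyVelocity E γ) (g.adDagger (bodyVelocity E γ t) (bodyVelocity E γ t)) t := by
  obtain ⟨u', -, hu'⟩ := hγ.bodyVelocity_weakSmooth.exists_deriv
  refine (hu' t).congr_deriv ?_
  have h := congrArg (leftTriv (γ t)) (hγ.2 t)
  rw [leftTriv_covDeriv, leftTriv_zero] at h
  change deriv (bodyVelocity E γ) t + g.nabla (bodyVelocity E γ t) (bodyVelocity E γ t) = 0 at h
  rw [deriv_eq_of_hasWeakDerivAt (hu' t), ScalarProduct.nabla, lie_self] at h
  rw [← sub_eq_zero, ← h]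
  module

lemma isJacobiField_iff (hγ : IsGeodesic g γ) (Y : ∀ t, TangentSpace 𝓘(ℝ, E) (γ t)) :
    IsJacobiField g γ Y ↔ IsAlgebraicJacobi g (bodyVelocity E γ) (fun t => leftTriv (γ t) (Y t)) := by
  rw [IsJacobiField, IsAlgebraicJacobi, smoothAlong_iff]
  refine and_congr_right fun hY => ?_
  obtain ⟨y', hy's, hy'⟩ := hY.exists_deriv
  obtain ⟨y'', -, hy''⟩ := hy's.exists_deriv
  have hu := hγ.bodyVelocity_hasWeakDerivAt
  have hD (t : ℝ) : leftTriv (γ t) (covDeriv g γ Y t) =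
      y' t + g.nabla (bodyVelocity E γ t) (leftTriv (γ t) (Y t)) := by
    rw [leftTriv_covDeriv, deriv_eq_of_hasWeakDerivAt (hy' t)]
    rfl
  have hDD (t : ℝ) : leftTriv (γ t) (covDeriv g γ (covDeriv g γ Y) t
      + curvature g (γ t) (Y t) (velocity γ t) (velocity γ t)) =
      (y'' t + (⁅g.adDagger (bodyVelocity E γ t) (bodyVelocity E γ t), leftTriv (γ t) (Y t)⁆ +
        ⁅bodyVelocity E γ t, y' t⁆)) -
      (g.adDagger (y' t + ⁅bodyVelocity E γ t, leftTriv (γ t) (Y t)⁆) (bodyVelocity E γ t) +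
        g.adDagger (bodyVelocity E γ t) (y' t + ⁅bodyVelocity E γ t, leftTriv (γ t) (Y t)⁆)) := by
    have h1 := (hy'' t).add ((hu t).bilin (nablaBilin g) (hy' t))
    simp only [nablaBilin_apply] at h1
    rw [leftTriv_add, leftTriv_covDeriv, leftTriv_curvature]
    simp only [hD]
    rw [deriv_eq_of_hasWeakDerivAt h1, ← jacobi_operator_eq]
    rfl
  have hw (t : ℝ) : HasWeakDerivAt
      (fun s => y' s + ⁅bodyVelocity E γ s, (leftTriv (γ s) (Y s) : GroupLieAlgebra 𝓘(ℝ, E) N)⁆)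
      (y'' t + (⁅g.adDagger (bodyVelocity E γ t) (bodyVelocity E γ t), leftTriv (γ t) (Y t)⁆ +
        ⁅bodyVelocity E γ t, y' t⁆)) t :=
    (hy'' t).add ((hu t).bilin (lieBilin _) (hy' t))
  constructor
  · intro h
    refine ⟨y', hy', fun t => (hw t).congr_deriv ?_⟩
    rw [← sub_eq_zero, ← hDD, h, leftTriv_zero]
  · rintro ⟨z, hz, hzw⟩ t
    obtain rfl : z = y' := funext fun t => (hz t).unique (hy' t)
    apply leftTriv_injective
    rw [hDD, leftTriv_zero, sub_eq_zero]
    exact (hw t).unique (hzw t)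

end IsGeodesic

end JacobiFields

/-! ### Conjugate points from parametrized Jacobi fields -/

section ConjugatePoints

variable {E : Type*} [NormedAddCommGroup E] [NormedSpace ℝ E] [FiniteDimensional ℝ E]
  {N : Type*} [TopologicalSpace N] [ChartedSpace E N] [Group N] [LieGroup 𝓘(ℝ, E) ∞ N]
  {g : ScalarProduct (GroupLieAlgebra 𝓘(ℝ, E) N)} {γ : ℝ → N}

/-- Vector fields along a curve from curves in the Lie algebra. -/
def fieldAlong (γ : ℝ → N) :
    (ℝ → GroupLieAlgebra 𝓘(ℝ, E) N) →ₗ[ℝ] ∀ t, TangentSpace 𝓘(ℝ, E) (γ t) where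
  toFun y t := mulInvariantVectorField (y t) (γ t)
  map_add' y y' := funext fun t => by
    simp only [Pi.add_apply, mulInvariantVectorField_add]
  map_smul' c y := funext fun t => by
    simp only [Pi.smul_apply, mulInvariantVectorField_smul, RingHom.id_apply]

omit [FiniteDimensional ℝ E] in
lemma leftTriv_fieldAlong (y : ℝ → GroupLieAlgebra 𝓘(ℝ, E) N) (t : ℝ) :
    leftTriv (γ t) (fieldAlong γ y t) = y t :=
  leftTriv_mulInvariantVectorField _ _

omit [FiniteDimensional ℝ E] in
lemma fieldAlong_leftTriv (Y : ∀ t, TangentSpace 𝓘(ℝ, E) (γ t)) :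
    fieldAlong γ (fun t => leftTriv (γ t) (Y t)) = Y :=
  funext fun _ => mulInvariantVectorField_leftTriv _ _

omit [FiniteDimensional ℝ E] in
lemma fieldAlong_apply_eq_zero_iff (y : ℝ → GroupLieAlgebra 𝓘(ℝ, E) N) (t : ℝ) :
    fieldAlong γ y t = 0 ↔ y t = 0 := by
  rw [← (leftTriv_injective (γ t)).eq_iff, leftTriv_fieldAlong, leftTriv_zero]

/-- Conjugate points and multiplicities from a linear parametrization of the Jacobi fields that
vanish at the initial point. -/
lemma IsGeodesic.conjugate_iff_and_multCp_eq (hγ : IsGeodesic g γ) {P : Type*} [AddCommGroup P]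
    [Module ℝ P] (Λ : P →ₗ[ℝ] ℝ → GroupLieAlgebra 𝓘(ℝ, E) N)
    (hinj : Function.Injective Λ)
    (hΛ : ∀ y, IsAlgebraicJacobi g (bodyVelocity E γ) y ∧ y 0 = 0 ↔ y ∈ LinearMap.range Λ)
    {t : ℝ} {S : Submodule ℝ P} (hS : ∀ p, Λ p t = 0 ↔ p ∈ S) :
    (IsConjugate g γ t ↔ t ≠ 0 ∧ S ≠ ⊥) ∧ multCp g γ t = Module.finrank ℝ S := by
  have hLinj : Function.Injective (fieldAlong γ ∘ₗ Λ) := by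
    rw [injective_iff_map_eq_zero]
    intro p hp
    refine (injective_iff_map_eq_zero Λ).1 hinj p (funext fun s => ?_)
    rw [Pi.zero_apply, ← fieldAlong_apply_eq_zero_iff (γ := γ)]
    exact congrFun hp s
  have hset : {Y : ∀ t, TangentSpace 𝓘(ℝ, E) (γ t) | IsJacobiField g γ Y ∧ Y 0 = 0 ∧ Y t = 0} =
      Submodule.map (fieldAlong γ ∘ₗ Λ) S := by
    ext Y
    have hY (s : ℝ) : Y s = 0 ↔ (leftTriv (γ s) (Y s) : GroupLieAlgebra 𝓘(ℝ, E) N) = 0 := by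
      rw [← fieldAlong_apply_eq_zero_iff (γ := γ) (fun s => leftTriv (γ s) (Y s)),
        fieldAlong_leftTriv]
    rw [Set.mem_ofPred_eq, hγ.isJacobiField_iff, ← and_assoc, hY 0, hΛ]
    constructor
    · rintro ⟨⟨p, hp⟩, ht⟩
      refine ⟨p, (hS p).1 ?_, ?_⟩
      · rw [hp]
        exact (hY t).1 ht
      · rw [LinearMap.comp_apply, hp, fieldAlong_leftTriv]
    · rintro ⟨p, hp, rfl⟩
      refine ⟨⟨p, funext fun s => (leftTriv_fieldAlong _ _).symm⟩, ?_⟩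
      rw [LinearMap.comp_apply, fieldAlong_apply_eq_zero_iff]
      exact (hS p).2 hp
  constructor
  · refine and_congr_right fun _ => ?_
    rw [Submodule.ne_bot_iff]
    constructor
    · rintro ⟨Y, h1, h2, h3⟩
      have : Y ∈ (Submodule.map (fieldAlong γ ∘ₗ Λ) S : Set _) := hset ▸ ⟨h1, h3⟩
      obtain ⟨p, hp, rfl⟩ := this
      exact ⟨p, hp, fun h => h2 (by rw [h, map_zero])⟩
    · rintro ⟨p, hp, hp0⟩
      have : (fieldAlong γ ∘ₗ Λ) p ∈ (Submodule.map (fieldAlong γ ∘ₗ Λ) S : Set _) := ⟨p, hp, rfl⟩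
      rw [← hset] at this
      exact ⟨_, this.1, fun h => hp0 (hLinj (by rw [h, map_zero])), this.2⟩
  · rw [multCp, hset, Submodule.span_eq, ← (Submodule.equivMapOfInjective _ hLinj S).finrank_eq]

namespace IsGenerator

variable {e : centerSpace (GroupLieAlgebra 𝓘(ℝ, E) N)} (he : IsGenerator g e)

lemma centralCoord_bodyVelocity (he : IsGenerator g e)
    (h2 : ∀ x y : GroupLieAlgebra 𝓘(ℝ, E) N, ⁅x, y⁆ ∈ centerSpace (GroupLieAlgebra 𝓘(ℝ, E) N))
    (hγ : IsGeodesic g γ) (t : ℝ) :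
    centralCoord g e (bodyVelocity E γ t) = centralCoord g e (bodyVelocity E γ 0) := by
  refine eq_const_of_hasDerivAt_zero (f := fun t => centralCoord g e (bodyVelocity E γ t))
    (fun t => ?_) t
  have := hγ.bodyVelocity_hasWeakDerivAt t (centralCoord g e)
  rwa [he.adDagger_eq h2, map_smul, centralCoord_vSpace, smul_zero] at this

lemma proj_bodyVelocity_hasWeakDerivAt (h2 : ∀ x y : GroupLieAlgebra 𝓘(ℝ, E) N,
    ⁅x, y⁆ ∈ centerSpace (GroupLieAlgebra 𝓘(ℝ, E) N)) (hγ : IsGeodesic g γ) (t : ℝ) :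
    HasWeakDerivAt (fun t => he.proj (bodyVelocity E γ t))
      (centralCoord g e (bodyVelocity E γ 0) • g.J e (he.proj (bodyVelocity E γ t))) t := by
  have := (hγ.bodyVelocity_hasWeakDerivAt t).map he.proj
  rwa [he.adDagger_eq h2, map_smul, he.proj_vSpace, he.centralCoord_bodyVelocity h2 hγ] at this

/-- The Jacobi fields that vanish at the initial point, from a parametrization of the solutions of
the reduced equation. -/
lemma mem_range_iff (h2 : ∀ x y : GroupLieAlgebra 𝓘(ℝ, E) N,
    ⁅x, y⁆ ∈ centerSpace (GroupLieAlgebra 𝓘(ℝ, E) N)) {u : ℝ → GroupLieAlgebra 𝓘(ℝ, E) N} {k : ℝ}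
    (hk : ∀ t, centralCoord g e (u t) = k) {P : Type*} [AddCommGroup P] [Module ℝ P]
    (Λ : P →ₗ[ℝ] ℝ → GroupLieAlgebra 𝓘(ℝ, E) N) {A : P → ℝ → ℝ} {b : P → ℝ → g.vSpace}
    (hΛ : ∀ p t, Λ p t = A p t • (e : GroupLieAlgebra 𝓘(ℝ, E) N) + b p t)
    (hA : ∀ p, ContDiff ℝ ∞ (A p)) (hb : ∀ p, WeakSmooth (b p))
    (hA0 : ∀ p, A p 0 = 0) (hb0 : ∀ p, b p 0 = 0)
    (hsol : ∀ p, ReducedJacobi (g.form.restrict g.vSpace) (g.J e) (g.form e e) k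
      (fun t => he.proj (u t)) (A p) (b p))
    (hex : ∀ a' b', ReducedJacobi (g.form.restrict g.vSpace) (g.J e) (g.form e e) k
      (fun t => he.proj (u t)) a' b' → a' 0 = 0 → b' 0 = 0 → ∃ p, a' = A p ∧ b' = b p)
    (y : ℝ → GroupLieAlgebra 𝓘(ℝ, E) N) :
    IsAlgebraicJacobi g u y ∧ y 0 = 0 ↔ y ∈ LinearMap.range Λ := by
  rw [he.isAlgebraicJacobi_iff h2 hk]
  constructor
  · rintro ⟨⟨-, h⟩, h0⟩
    obtain ⟨p, h3, h4⟩ := hex _ _ h (by simp [h0]) (by simp [h0])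
    refine ⟨p, funext fun t => ?_⟩
    rw [hΛ, ← h3, ← h4, he.decomp]
  · rintro ⟨p, rfl⟩
    have h3 (t : ℝ) : centralCoord g e (Λ p t) = A p t := by
      rw [hΛ, map_add, map_smul, he.centralCoord_self, centralCoord_vSpace, smul_eq_mul, mul_one,
        add_zero]
    have h4 (t : ℝ) : he.proj (Λ p t) = b p t := by
      rw [hΛ, map_add, map_smul, he.proj_self, smul_zero, zero_add, he.proj_vSpace]
    refine ⟨⟨?_, ?_⟩, ?_⟩
    · rw [funext (hΛ p)]
      exact (WeakSmooth.smul (hA p) (WeakSmooth.const _)).add ((hb p).map g.vSpace.subtype)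
    · simp only [h3, h4]
      exact hsol p
    · rw [hΛ, hA0, hb0]
      simp

lemma smul_add_eq_zero_iff (he : IsGenerator g e) (a : ℝ) (v : g.vSpace) :
    a • (e : GroupLieAlgebra 𝓘(ℝ, E) N) + v = 0 ↔ a = 0 ∧ v = 0 := by
  constructor
  · intro h
    constructor
    · have := congrArg (centralCoord g e) h
      rwa [map_add, map_smul, he.centralCoord_self, centralCoord_vSpace, smul_eq_mul, mul_one,
        add_zero, map_zero] at this
    · have := congrArg he.proj h
      rwa [map_add, map_smul, he.proj_self, smul_zero, zero_add, he.proj_vSpace,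
        map_zero] at this
  · rintro ⟨rfl, rfl⟩
    simp

variable {x₀ : g.vSpace}

lemma proj_bodyVelocity (h2 : ∀ x y : GroupLieAlgebra 𝓘(ℝ, E) N,
    ⁅x, y⁆ ∈ centerSpace (GroupLieAlgebra 𝓘(ℝ, E) N)) (hγ : IsGeodesic g γ)
    (hv : bodyVelocity E γ 0 = (e : GroupLieAlgebra 𝓘(ℝ, E) N) + x₀) (t : ℝ) :
    he.proj (bodyVelocity E γ t) = expEnd (t • g.J e) x₀ := by
  have h := he.proj_bodyVelocity_hasWeakDerivAt h2 hγ
  rw [hv, map_add, he.centralCoord_self, centralCoord_vSpace, add_zero] at h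
  simp only [one_smul] at h
  have := eq_expEnd_of_hasWeakDerivAt (g.J e) h t
  rw [hv, map_add, he.proj_self, zero_add, he.proj_vSpace] at this
  exact this

lemma metric_velocity (he : IsGenerator g e) (h2 : ∀ x y : GroupLieAlgebra 𝓘(ℝ, E) N,
    ⁅x, y⁆ ∈ centerSpace (GroupLieAlgebra 𝓘(ℝ, E) N)) (hγ : IsGeodesic g γ)
    (hv : bodyVelocity E γ 0 = (e : GroupLieAlgebra 𝓘(ℝ, E) N) + x₀) (t : ℝ) :
    metric g (γ t) (velocity γ t) (velocity γ t) =
      g.form e e + g.form.restrict g.vSpace x₀ x₀ := by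
  change g.form (bodyVelocity E γ t) (bodyVelocity E γ t) = _
  rw [he.form_self_eq, he.centralCoord_bodyVelocity h2 hγ, hv, map_add, he.centralCoord_self,
    centralCoord_vSpace, he.proj_bodyVelocity h2 hγ hv,
    ← form_expEnd_expEnd _ (form_J_skew e) t x₀ x₀]
  change _ + g.form (expEnd (t • g.J e) x₀) (expEnd (t • g.J e) x₀) =
    _ + g.form (expEnd (t • g.J e) x₀) (expEnd (t • g.J e) x₀)
  ring

/-- Conjugate points along a geodesic that is not orthogonal to the center. -/
lemma conjugate_iff_solSpace (he : IsGenerator g e) (h2 : ∀ x y : GroupLieAlgebra 𝓘(ℝ, E) N,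
    ⁅x, y⁆ ∈ centerSpace (GroupLieAlgebra 𝓘(ℝ, E) N)) (hγ : IsGeodesic g γ)
    (hv : bodyVelocity E γ 0 = (e : GroupLieAlgebra 𝓘(ℝ, E) N) + x₀) {t : ℝ} (ht : t ≠ 0) :
    (IsConjugate g γ t ↔ solSpace (g.form.restrict g.vSpace) (g.J e) x₀
      (metric g (γ t) (velocity γ t) (velocity γ t)) t ≠ ⊥) ∧
    multCp g γ t = Module.finrank ℝ (solSpace (g.form.restrict g.vSpace) (g.J e) x₀
      (metric g (γ t) (velocity γ t) (velocity γ t)) t) := by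
  let Λ : ℝ × g.vSpace →ₗ[ℝ] ℝ → GroupLieAlgebra 𝓘(ℝ, E) N :=
    { toFun := fun p t => centralComponent (g.form.restrict g.vSpace) (g.J e) (g.form e e) x₀ p t •
        (e : GroupLieAlgebra 𝓘(ℝ, E) N) + orthComponent (g.J e) x₀ p t
      map_add' := fun p p' => funext fun t => by
        simp only [centralComponent, orthComponent, Prod.fst_add, Prod.snd_add, map_add,
          Submodule.coe_add, Submodule.coe_sub, Submodule.coe_smul, Pi.add_apply]
        module
      map_smul' := fun c p => funext fun t => by
        simp only [centralComponent, orthComponent, Prod.smul_fst, Prod.smul_snd, map_smul,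
          Submodule.coe_add, Submodule.coe_sub, Submodule.coe_smul, Pi.smul_apply, smul_eq_mul,
          RingHom.id_apply]
        module }
  have hΛ (p : ℝ × g.vSpace) (t : ℝ) : Λ p t =
    centralComponent (g.form.restrict g.vSpace) (g.J e) (g.form e e) x₀ p t •
        (e : GroupLieAlgebra 𝓘(ℝ, E) N) + orthComponent (g.J e) x₀ p t := rfl
  have hj := he.J_injective h2
  have hskew := form_J_skew (g := g) e
  have hk (t : ℝ) : centralCoord g e (bodyVelocity E γ t) = 1 := by
    rw [he.centralCoord_bodyVelocity h2 hγ, hv, map_add, he.centralCoord_self,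
      centralCoord_vSpace, add_zero]
  have h := hγ.conjugate_iff_and_multCp_eq (t := t) Λ (by
      rw [injective_iff_map_eq_zero]
      intro p hp
      have h0 (t : ℝ) := (he.smul_add_eq_zero_iff _ _).1 ((hΛ p t).symm.trans (congrFun hp t))
      exact eq_zero_of_components_eq_zero hj (fun t => (h0 t).1) fun t => (h0 t).2)
    (he.mem_range_iff h2 hk Λ hΛ (centralComponent_contDiff _ _ _ _)
      (orthComponent_weakSmooth _ _) (centralComponent_zero _ _ _ _) (orthComponent_zero _ _)
      (fun p => by
        simp only [he.proj_bodyVelocity h2 hγ hv]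
        exact reducedJacobi_components hskew form_restrict_isSymm p)
      (fun a b hab => by
        simp only [he.proj_bodyVelocity h2 hγ hv] at hab
        exact exists_components_of_reducedJacobi hskew form_restrict_isSymm hj hab))
    (S := solSpace (g.form.restrict g.vSpace) (g.J e) x₀
      (metric g (γ t) (velocity γ t) (velocity γ t)) t) (fun p => by
      rw [hΛ, he.smul_add_eq_zero_iff, components_eq_zero_iff hskew he.form_ne ht,
        he.metric_velocity h2 hγ hv])
  exact ⟨h.1.trans (and_iff_right ht), h.2⟩

/-- Conjugate points along a geodesic orthogonal to the center. -/
lemma conjugate_iff_of_orthogonal (he : IsGenerator g e) (h2 : ∀ x y : GroupLieAlgebra 𝓘(ℝ, E) N,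
    ⁅x, y⁆ ∈ centerSpace (GroupLieAlgebra 𝓘(ℝ, E) N)) (hγ : IsGeodesic g γ)
    (hv : bodyVelocity E γ 0 = x₀) {t : ℝ} (ht : t ≠ 0) :
    (IsConjugate g γ t ↔ g.form (g.J e x₀) (g.J e x₀) = -12 * g.form e e / t ^ 2) ∧
    (g.form (g.J e x₀) (g.J e x₀) = -12 * g.form e e / t ^ 2 → multCp g γ t = 1) := by
  let Λ : ℝ × g.vSpace →ₗ[ℝ] ℝ → GroupLieAlgebra 𝓘(ℝ, E) N :=
    { toFun := fun p t => horizontalCentralComponent (g.form.restrict g.vSpace) (g.J e)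
        (g.form e e) x₀ p t • (e : GroupLieAlgebra 𝓘(ℝ, E) N) +
        horizontalOrthComponent (g.J e) x₀ p t
      map_add' := fun p p' => funext fun t => by
        simp only [horizontalCentralComponent, horizontalOrthComponent, Prod.fst_add,
          Prod.snd_add, map_add, Submodule.coe_add, Submodule.coe_smul, Pi.add_apply]
        module
      map_smul' := fun c p => funext fun t => by
        simp only [horizontalCentralComponent, horizontalOrthComponent, Prod.smul_fst,
          Prod.smul_snd, map_smul, Submodule.coe_add, Submodule.coe_smul, Pi.smul_apply,
          smul_eq_mul, RingHom.id_apply]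
        module }
  have hΛ (p : ℝ × g.vSpace) (t : ℝ) : Λ p t =
    horizontalCentralComponent (g.form.restrict g.vSpace) (g.J e) (g.form e e) x₀ p t •
        (e : GroupLieAlgebra 𝓘(ℝ, E) N) + horizontalOrthComponent (g.J e) x₀ p t := rfl
  have hk (t : ℝ) : centralCoord g e (bodyVelocity E γ t) = 0 := by
    rw [he.centralCoord_bodyVelocity h2 hγ, hv, centralCoord_vSpace]
  have hproj (t : ℝ) : he.proj (bodyVelocity E γ t) = x₀ := by
    have h := he.proj_bodyVelocity_hasWeakDerivAt h2 hγ
    simp only [hk, zero_smul] at h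
    rw [HasWeakDerivAt.eq_const h, hv, he.proj_vSpace]
  have hinj : Function.Injective Λ := by
    rw [injective_iff_map_eq_zero]
    intro p hp
    have h0 (t : ℝ) := (he.smul_add_eq_zero_iff _ _).1 ((hΛ p t).symm.trans (congrFun hp t))
    exact eq_zero_of_horizontal_eq_zero (fun t => (h0 t).1) fun t => (h0 t).2
  have hrange := he.mem_range_iff h2 hk Λ hΛ (horizontalCentralComponent_contDiff _ _ _ _)
    (horizontalOrthComponent_weakSmooth _ _) (fun p => by simp [horizontalCentralComponent])
    (fun p => by simp [horizontalOrthComponent])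
    (fun p => by
      simp only [hproj]
      exact reducedJacobi_horizontal p)
    (fun a b hab => by
      simp only [hproj] at hab
      exact exists_horizontal_of_reducedJacobi hab)
  have hzero (p : ℝ × g.vSpace) : Λ p t = 0 ↔ p.2 = (-(p.1 * t / 2)) • g.J e x₀ ∧
      (p.1 = 0 ∨ g.form (g.J e x₀) (g.J e x₀) = -12 * g.form e e / t ^ 2) := by
    rw [hΛ, he.smul_add_eq_zero_iff, horizontal_eq_zero_iff he.form_ne ht]
    rfl
  by_cases hQ : g.form (g.J e x₀) (g.J e x₀) = -12 * g.form e e / t ^ 2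
  · have hne : ((1, (-(t / 2)) • g.J e x₀) : ℝ × g.vSpace) ≠ 0 := fun h =>
      one_ne_zero (congrArg Prod.fst h)
    have h := hγ.conjugate_iff_and_multCp_eq (t := t) Λ hinj hrange
      -- When the numerical condition holds, `c` is free and determines `q = -(c t / 2) j x₀`, so
      -- the solutions form this line.
      (S := ℝ ∙ ((1, (-(t / 2)) • g.J e x₀) : ℝ × g.vSpace)) (fun p => by
        rw [hzero, Submodule.mem_span_singleton]
        constructor
        · rintro ⟨h3, -⟩
          refine ⟨p.1, Prod.ext (by simp) ?_⟩
          rw [h3, Prod.smul_snd]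
          module
        · rintro ⟨c, rfl⟩
          refine ⟨?_, Or.inr hQ⟩
          simp only [Prod.smul_mk, smul_eq_mul]
          module)
    refine ⟨iff_of_true (h.1.2 ⟨ht, by simp⟩) hQ, fun _ => ?_⟩
    rw [h.2, finrank_span_singleton hne]
  · have h := hγ.conjugate_iff_and_multCp_eq (t := t) Λ hinj hrange (S := ⊥) (fun p => by
      rw [hzero, Submodule.mem_bot, or_iff_left hQ]
      constructor
      · rintro ⟨h3, h4⟩
        exact Prod.ext h4 (by simp [h3, h4])
      · rintro rfl
        simp)
    exact ⟨iff_of_false (fun hc => (h.1.1 hc).2 rfl) hQ, fun h => absurd h hQ⟩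

end IsGenerator

end ConjugatePoints

/-! ### When the parameter space is nontrivial -/

section SolutionSpace

variable {V : Type*} [AddCommGroup V] [Module ℝ V] [FiniteDimensional ℝ V]
  {B : LinearMap.BilinForm ℝ V} {J : Module.End ℝ V} {x₀ : V} {G t : ℝ}

lemma solSpace_ne_bot_of_mem_resonantTimes (ht : t ∈ resonantTimes J) :
    solSpace B J x₀ G t ≠ ⊥ := by
  obtain ⟨q, hq, hq0, hf⟩ := exists_mem_ker_expSub_of_mem_resonantTimes ht (B (J x₀))
  rw [Submodule.ne_bot_iff]
  refine ⟨(0, q), ⟨?_, ?_⟩, fun h => hq0 (congrArg Prod.snd h)⟩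
  · rw [zero_mul, zero_smul]
    exact hq
  · rw [zero_mul]
    exact hf.symm

lemma solSpace_ne_bot_of_finrank_pos (h : 0 < Module.finrank ℝ (solSpace B J x₀ G t)) :
    solSpace B J x₀ G t ≠ ⊥ := by
  intro h0
  rw [h0, finrank_bot] at h
  exact h.false

lemma ne_zero_of_isUnit_expSub (hx : x₀ ≠ 0) (h : IsUnit (expSub J t)) : t ≠ 0 := by
  rintro rfl
  refine hx (((Module.End.isUnit_iff _).1 h).1 ?_)
  simp [expSub]

lemma expSub_smul_inverse (h : IsUnit (expSub J t)) :
    expSub J t (t • Ring.inverse (expSub J t) x₀) = t • x₀ := by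
  rw [map_smul, ← Module.End.mul_apply, Ring.mul_inverse_cancel _ h, Module.End.one_apply]

lemma finrank_ker_expSub_of_isUnit (h : IsUnit (expSub J t)) :
    Module.finrank ℝ (LinearMap.ker (expSub J t)) = 0 := by
  rw [(LinearMap.isUnit_iff_ker_eq_bot _).1 h, finrank_bot]

lemma finrank_solSpace_of_isUnit (hskew : ∀ x y, B (J x) y = - B x (J y)) (ht : t ≠ 0)
    (h : IsUnit (expSub J t)) (hG : t * B (J x₀) (Ring.inverse (expSub J t) x₀) = G) :
    Module.finrank ℝ (solSpace B J x₀ G t) = 1 := by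
  rw [finrank_solSpace_of_eq hskew ht (expSub_smul_inverse h) (by rw [map_smul, smul_eq_mul, hG]),
    finrank_ker_expSub_of_isUnit h]

/-- Off the resonant times `e^{-tJ} - I` is invertible and `v = t (e^{-tJ} - I)⁻¹ x₀` is the only
candidate, so the dimension is `1` or `0` according to the value of `B (J x₀) v`. At a resonant time
a kernel vector killed by `B (J x₀)` gives a solution with `c = 0`. -/
lemma solSpace_ne_bot_iff (hskew : ∀ x y, B (J x) y = - B x (J y)) (hJ : Function.Injective J)
    (ht : t ≠ 0) : solSpace B J x₀ G t ≠ ⊥ ↔ t ∈ resonantTimes J ∨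
      (IsUnit (expSub J t) ∧ t * B (J x₀) (Ring.inverse (expSub J t) x₀) = G) := by
  constructor
  · intro h
    rw [or_iff_not_imp_left, mem_resonantTimes_iff hJ ht, not_not]
    intro hker
    have hU : IsUnit (expSub J t) := (LinearMap.isUnit_iff_ker_eq_bot _).2 hker
    refine ⟨hU, ?_⟩
    by_contra hG
    have := finrank_solSpace_of_ne (G := G) hskew ht (expSub_smul_inverse hU)
      (by rwa [map_smul, smul_eq_mul])
    rw [finrank_ker_expSub_of_isUnit hU] at this
    exact h (Submodule.finrank_eq_zero.1 this)
  · rintro (h | ⟨hU, hG⟩)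
    · exact solSpace_ne_bot_of_mem_resonantTimes h
    · exact solSpace_ne_bot_of_finrank_pos
        (by rw [finrank_solSpace_of_isUnit hskew ht hU hG]; exact one_pos)

end SolutionSpace

end TwoStep

end

/-! ### The three cases of the theorem -/

theorem theorem3
    {E : Type*} [NormedAddCommGroup E] [NormedSpace ℝ E] [FiniteDimensional ℝ E]
    {N : Type*} [TopologicalSpace N] [ChartedSpace E N] [Group N] [LieGroup 𝓘(ℝ, E) ∞ N]
    [SimplyConnectedSpace N]
    (hN : TwoStep.IsTwoStepNilpotent (GroupLieAlgebra 𝓘(ℝ, E) N))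
    (g : TwoStep.ScalarProduct (GroupLieAlgebra 𝓘(ℝ, E) N))
    (hZ : g.CenterNondegenerate)
    (hdim : Module.finrank ℝ (TwoStep.centerSpace (GroupLieAlgebra 𝓘(ℝ, E) N)) = 1)
    (γ : ℝ → N) (hγ : TwoStep.IsGeodesic g γ) (hγ0 : γ 0 = 1)
    (z₀ : TwoStep.centerSpace (GroupLieAlgebra 𝓘(ℝ, E) N)) (x₀ : g.vSpace)
    (hv : TwoStep.leftTriv (γ 0) (TwoStep.velocity γ 0)
      = (z₀ : GroupLieAlgebra 𝓘(ℝ, E) N) + (x₀ : GroupLieAlgebra 𝓘(ℝ, E) N)) :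
    -- initial velocity tangent to the center
    (z₀ ≠ 0 → x₀ = 0 →
      (∀ t : ℝ, TwoStep.IsConjugate g γ t ↔ t ∈ TwoStep.resonantTimes (g.J z₀)) ∧
      ∀ l ∈ TwoStep.freq (g.J z₀), ∀ n : ℤ, n ≠ 0 →
        TwoStep.multCp g γ (2 * Real.pi / l * n) = TwoStep.multSum (g.J z₀) l n ∧
        TwoStep.multSum (g.J z₀) l n ≤ Module.finrank ℝ g.vSpace) ∧
    -- initial velocity orthogonal to the center
    (z₀ = 0 → x₀ ≠ 0 →
      (∀ z : TwoStep.centerSpace (GroupLieAlgebra 𝓘(ℝ, E) N), ∀ ε : ℝ,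
        (ε = 1 ∨ ε = -1) → g.form z z = ε →
        ∀ t : ℝ, TwoStep.IsConjugate g γ t ↔
          t ≠ 0 ∧ -12 / t ^ 2 = ε * g.form (g.J z x₀) (g.J z x₀)) ∧
      ∀ t : ℝ, TwoStep.IsConjugate g γ t → TwoStep.multCp g γ t = 1) ∧
    -- both components nonzero
    (z₀ ≠ 0 → x₀ ≠ 0 →
      (∀ t : ℝ, TwoStep.IsConjugate g γ t ↔
        t ∈ TwoStep.resonantTimes (g.J z₀) ∨
        (IsUnit (TwoStep.expSub (g.J z₀) t) ∧
          t * g.form (g.J z₀ x₀) (Ring.inverse (TwoStep.expSub (g.J z₀) t) x₀)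
            = TwoStep.metric g (γ t) (TwoStep.velocity γ t) (TwoStep.velocity γ t))) ∧
      (∀ t : ℝ, IsUnit (TwoStep.expSub (g.J z₀) t) →
        t * g.form (g.J z₀ x₀) (Ring.inverse (TwoStep.expSub (g.J z₀) t) x₀)
          = TwoStep.metric g (γ t) (TwoStep.velocity γ t) (TwoStep.velocity γ t) →
        TwoStep.multCp g γ t = 1) ∧
      ∀ l ∈ TwoStep.freq (g.J z₀), ∀ n : ℤ, n ≠ 0 → ∀ t : ℝ, t = 2 * Real.pi / l * n →
        (x₀ ∉ LinearMap.range (TwoStep.expSub (g.J z₀) t) →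
          (TwoStep.multCp g γ t : ℤ) = TwoStep.multSum (g.J z₀) l n - 1) ∧
        (x₀ ∈ LinearMap.range (TwoStep.expSub (g.J z₀) t) →
          ∀ v : g.vSpace, TwoStep.expSub (g.J z₀) t v = t • x₀ →
            (g.form (g.J z₀ x₀) v
                = TwoStep.metric g (γ t) (TwoStep.velocity γ t) (TwoStep.velocity γ t) →
              TwoStep.multCp g γ t = TwoStep.multSum (g.J z₀) l n + 1) ∧
            (g.form (g.J z₀ x₀) v
                ≠ TwoStep.metric g (γ t) (TwoStep.velocity γ t) (TwoStep.velocity γ t) →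
              TwoStep.multCp g γ t = TwoStep.multSum (g.J z₀) l n))) := by
  have h2 := hN.2
  have hv' : TwoStep.bodyVelocity E γ 0 =
    (z₀ : GroupLieAlgebra 𝓘(ℝ, E) N) + (x₀ : GroupLieAlgebra 𝓘(ℝ, E) N) := hv
  have hskew := TwoStep.form_J_skew (g := g) z₀
  refine ⟨fun hz hx => ?_, fun hz hx => ?_, fun hz hx => ?_⟩
  · have he := TwoStep.isGenerator_of_ne_zero hZ hdim hz
    have hJ := he.J_injective h2
    -- For `x₀ = 0` the vector `v = 0` solves `(e^{-tJ} - I) v = t x₀`, and `⟨γ', γ'⟩ = ⟨z₀, z₀⟩ ≠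
    -- 0`; so the multiplicity is the dimension of the kernel.
    have hdimS (t : ℝ) (ht : t ≠ 0) := TwoStep.finrank_solSpace_of_ne (x₀ := x₀)
      (G := TwoStep.metric g (γ t) (TwoStep.velocity γ t) (TwoStep.velocity γ t))
      hskew ht (v := 0) (by simp [hx]) (by
        rw [he.metric_velocity h2 hγ hv', hx]
        simpa using he.form_ne.symm)
    refine ⟨fun t => ?_, fun l hl n hn => ⟨?_, ?_⟩⟩
    · by_cases ht : t = 0
      · exact iff_of_false (fun h => h.1 ht) fun h => TwoStep.ne_zero_of_mem_resonantTimes h ht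
      · rw [(he.conjugate_iff_solSpace h2 hγ hv' ht).1, TwoStep.mem_resonantTimes_iff hJ ht, Ne, Ne,
          ← Submodule.finrank_eq_zero, hdimS t ht, Submodule.finrank_eq_zero]
    · have ht := TwoStep.ne_zero_of_mem_resonantTimes ⟨l, hl, n, hn, rfl⟩
      rw [(he.conjugate_iff_solSpace h2 hγ hv' ht).2, hdimS _ ht, TwoStep.finrank_ker_expSub hJ hl hn]
    · rw [← TwoStep.finrank_ker_expSub hJ hl hn]
      exact Submodule.finrank_le _
  · have hv0 : TwoStep.bodyVelocity E γ 0 = x₀ := by rw [hv', hz]; simp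
    constructor
    · intro z ε hε hzε t
      have hz0 : z ≠ 0 := by
        rintro rfl
        rcases hε with rfl | rfl <;> simp at hzε
      have he := TwoStep.isGenerator_of_ne_zero hZ hdim hz0
      by_cases ht : t = 0
      · exact iff_of_false (fun h => h.1 ht) fun h => h.1 ht
      · rw [(he.conjugate_iff_of_orthogonal h2 hγ hv0 ht).1, hzε, and_iff_right ht]
        rcases hε with rfl | rfl
        · rw [mul_one, one_mul, eq_comm]
        · constructor
          · intro h
            rw [h]
            ring
          · intro h
            linear_combination h
    · intro t ht
      -- For the multiplicity any nonzero central vector serves as generator; it need not be a unit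
      -- vector.
      have : Nontrivial (TwoStep.centerSpace (GroupLieAlgebra 𝓘(ℝ, E) N)) :=
        Module.nontrivial_of_finrank_pos (R := ℝ) (by rw [hdim]; exact one_pos)
      obtain ⟨z, hz0⟩ := exists_ne (0 : TwoStep.centerSpace (GroupLieAlgebra 𝓘(ℝ, E) N))
      have he := TwoStep.isGenerator_of_ne_zero hZ hdim hz0
      have h := he.conjugate_iff_of_orthogonal h2 hγ hv0 ht.1
      exact h.2 (h.1.1 ht)
  · have he := TwoStep.isGenerator_of_ne_zero hZ hdim hz
    have hJ := he.J_injective h2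
    refine ⟨fun t => ?_, fun t hU hG => ?_, fun l hl n hn t htn => ?_⟩
    · by_cases ht : t = 0
      · refine iff_of_false (fun h => h.1 ht) ?_
        rintro (h | ⟨h, -⟩)
        · exact TwoStep.ne_zero_of_mem_resonantTimes h ht
        · exact TwoStep.ne_zero_of_isUnit_expSub hx h ht
      · exact (he.conjugate_iff_solSpace h2 hγ hv' ht).1.trans
          (TwoStep.solSpace_ne_bot_iff hskew hJ ht)
    · have ht := TwoStep.ne_zero_of_isUnit_expSub hx hU
      rw [(he.conjugate_iff_solSpace h2 hγ hv' ht).2]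
      exact TwoStep.finrank_solSpace_of_isUnit hskew ht hU hG
    · have ht : t ≠ 0 := TwoStep.ne_zero_of_mem_resonantTimes ⟨l, hl, n, hn, htn⟩
      have hker : Module.finrank ℝ (LinearMap.ker (TwoStep.expSub (g.J z₀) t)) =
          TwoStep.multSum (g.J z₀) l n := by
        rw [htn, TwoStep.finrank_ker_expSub hJ hl hn]
      rw [(he.conjugate_iff_solSpace h2 hγ hv' ht).2, ← hker]
      refine ⟨fun hr => ?_, fun _ v hAv => ⟨fun hG => ?_, fun hG => ?_⟩⟩
      -- The count is available as multiplicity plus one equals the kernel dimension, which gives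
      -- the subtraction in `ℤ`.
      · rw [← TwoStep.finrank_solSpace_of_notMem_range he.form_restrict_nondegenerate
          TwoStep.form_restrict_isSymm hskew hJ ht hr]
        push_cast
        ring
      · exact TwoStep.finrank_solSpace_of_eq hskew ht hAv hG
      · exact TwoStep.finrank_solSpace_of_ne hskew ht hAv hG
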